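/- Let $M$ be a (finite-dimensional) complex manifold endowed with a holomorphic Riemannian metric $\langle\cdot,\cdot\rangle$, and let $L$ be a holomorphic line bundle over $M$ endowed with a holomorphic connection with curvature form $\Omega$, that is, $\Omega(X,Y)s=\nabla^L_X\nabla^L_Ys-\nabla^L_Y\nabla^L_Xs-\nabla^L_{[X,Y]}s$. Let $E=T(L\setminus0)/(\mathbb{C}\setminus\{0\})$ be the vector bundle over $M$ whose sections are the vector fields on $L\setminus0$ invariant under the action of $\mathbb{C}\setminus\{0\}$, let $\rho:E\to TM$ be the projection (induced by the differential of $L\setminus0\to M$), and endow the sections of $E$ with the bracket $[\cdot,\cdot]$ of invariant vector fields. Let $u$ be a nowhere zero holomorphic function on $M$, and let $\mathbf{1}$ be the section of $E$ such that $u\mathbf{1}$ is the infinitesimal generator of the action of $\mathbb{C}\setminus\{0\}$ on $L$. By using horizontal lifts with respect to the connection of $L$, regard $TM$ as a subbundle of $E$, so that $E=TM\oplus\mathbb{C}\mathbf{1}$. A $\rho$-connection on a vector bundle $W$ over $M$ associates to sections $e$ of $E$ and $\sigma$ of $W$ a section $\nabla_e\sigma$ of $W$, linear over functions in $e$, additive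 in $\sigma$, and such that $\nabla_e(f\sigma)=f\nabla_e\sigma+\rho(e)(f)\,\sigma$, for any function $f$ on $M$. Let $\nabla$ be a $\rho$-connection on $TM$, $\gamma$ a section of $\mathrm{Hom}(E,TM)$, $h$ a section of $\mathrm{Hom}(TM,\mathrm{End}(TM))$, and let $\widetilde\nabla$ be a $\rho$-connection on $E$ such that, for any local vector fields $X$ and $Y$ on $M$, \begin{align*} \widetilde\nabla_XY&=\nabla_XY+h(\gamma(X))Y-\langle\gamma(X),Y\rangle\mathbf{1},& \widetilde\nabla_X\mathbf{1}&=\gamma(X),\\ \widetilde\nabla_{\mathbf{1}}X&=\nabla_{\mathbf{1}}X+h(\gamma(\mathbf{1}))X-\langle\gamma(\mathbf{1}),X\rangle\mathbf{1},& \widetilde\nabla_{\mathbf{1}}\mathbf{1}&=\gamma(\mathbf{1}). \end{align*} Then the torsion $\widetilde T(a,b)=\widetilde\nabla_ab-\widetilde\nabla_ba-[a,b]$ of $\widetilde\nabla$ is given by \begin{align*} \widetilde T(X,Y)&=T(X,Y)+h(\gamma(X))Y-h(\gamma(Y))X+\bigl(u\,\Omega(X,Y)-\langle\gamma(X),Y\rangle+\langle\gamma(Y),X\rangle\bigr)\mathbf{1},\\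 \widetilde T(X,\mathbf{1})&=\gamma(X)-\nabla_{\mathbf{1}}X-h(\gamma(\mathbf{1}))X+\bigl(u^{-1}X(u)+\langle\gamma(\mathbf{1}),X\rangle\bigr)\mathbf{1}, \end{align*} for any local vector fields $X$ and $Y$ on $M$, where $T$ is the torsion of the connection on $M$ obtained by restricting $\nabla$ to $TM\subseteq E$. -/

import Mathlib

open Bundle Set
open scoped Manifold ContDiff Topology

noncomputable section

set_option linter.unusedSectionVars false

namespace LineBundleAtiyah

section Setting

/- `M` is a complex manifold modelled on the finite-dimensional complex vector space `V`,
and `L` is a holomorphic line bundle over `M`. -/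
variable {V : Type*} [NormedAddCommGroup V] [NormedSpace ℂ V]
  {M : Type*} [TopologicalSpace M] [ChartedSpace V M] [IsManifold 𝓘(ℂ, V) ω M]
  {L : M → Type*} [TopologicalSpace (TotalSpace ℂ L)]
  [∀ x, AddCommGroup (L x)] [∀ x, Module ℂ (L x)] [∀ x, TopologicalSpace (L x)]
  [∀ x, IsTopologicalAddGroup (L x)] [∀ x, ContinuousSMul ℂ (L x)]
  [FiberBundle ℂ L] [VectorBundle ℂ ℂ L] [ContMDiffVectorBundle ω ℂ L 𝓘(ℂ, V)]

variable (V) in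
/-- The tangent space at `l ∈ L x` of the total space of the line bundle `L`. -/
abbrev TotTangent (x : M) (l : L x) : Type _ :=
  TangentSpace (𝓘(ℂ, V).prod 𝓘(ℂ, ℂ)) (TotalSpace.mk x l : TotalSpace ℂ L)

/-- The action of a scalar on the total space of `L`. -/
def scale (a : ℂ) (p : TotalSpace ℂ L) : TotalSpace ℂ L := TotalSpace.mk p.1 (a • p.2)

variable (V) in
/-- The differential at `l` of the action of a scalar on the total space of `L`. -/
def dscale (a : ℂ) (x : M) (l : L x) : TotTangent V x l →L[ℂ] TotTangent V x (a • l) :=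
  mfderiv (𝓘(ℂ, V).prod 𝓘(ℂ, ℂ)) (𝓘(ℂ, V).prod 𝓘(ℂ, ℂ)) (scale (L := L) a) (TotalSpace.mk x l)

variable (V L) in
/-- The fibre at `x` of the vector bundle `E = T(L \ 0) / (ℂ \ {0})`: the vector fields on `L \ 0`,
along the fibre `L x \ {0}` (which is an orbit of `ℂ \ {0}`), that are invariant under the action of
`ℂ \ {0}`. Thus, sections of `E` are the invariant vector fields on `L \ 0`. -/
def AtiyahFiber (x : M) :
    Submodule ℂ (∀ l : {l : L x // l ≠ 0}, TotTangent V x (l : L x)) where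
  carrier := {Z | ∀ (a : ℂˣ) (l : {l : L x // l ≠ 0}),
    dscale V (a : ℂ) x (l : L x) (Z l) = Z ⟨(a : ℂ) • (l : L x), smul_ne_zero a.ne_zero l.2⟩}
  add_mem' := fun {Z W} hZ hW a l ↦ by
    simp only [mem_ofPred_eq] at hZ hW
    simp [hZ a l, hW a l]
  zero_mem' := fun a l ↦ by simp
  smul_mem' := fun c Z hZ a l ↦ by
    simp only [mem_ofPred_eq] at hZ
    simp [hZ a l]

variable (V L) in
/-- The space of (not necessarily regular) sections of `E`. -/
abbrev AtiyahSection : Type _ := ∀ x : M, AtiyahFiber V L x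

open Classical in
/-- The vector field on `L \ 0` given by a section of `E` (with the junk value `0` along the zero
section of `L`). -/
def toField (s : AtiyahSection V L) (p : TotalSpace ℂ L) :
    TangentSpace (𝓘(ℂ, V).prod 𝓘(ℂ, ℂ)) p :=
  if hp : p.2 ≠ 0 then (s p.1).1 ⟨p.2, hp⟩ else 0

/-- A section of `E` is differentiable at `x` if the corresponding invariant vector field on `L \ 0`
is differentiable at the points over `x`. -/
def AtiyahSection.DiffAt (s : AtiyahSection V L) (x : M) : Prop :=
  ∀ l : L x, l ≠ 0 → MDifferentiableAt (𝓘(ℂ, V).prod 𝓘(ℂ, ℂ)) (𝓘(ℂ, V).prod 𝓘(ℂ, ℂ)).tangent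
    (fun p : TotalSpace ℂ L ↦
      (⟨p, toField s p⟩ : TangentBundle (𝓘(ℂ, V).prod 𝓘(ℂ, ℂ)) (TotalSpace ℂ L)))
    (TotalSpace.mk x l)

open Classical in
/-- The bracket of two sections of `E` is the Lie bracket of the corresponding invariant vector
fields on `L \ 0`. (The latter is invariant if the sections are differentiable, see
`dscale_mlieBracket`; the value is `0` otherwise.) -/
def atiyahBracket (s t : AtiyahSection V L) : AtiyahSection V L := fun x ↦
  if hst : (fun l : {l : L x // l ≠ 0} ↦ (VectorField.mlieBracket (𝓘(ℂ, V).prod 𝓘(ℂ, ℂ))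
      (toField s) (toField t) (TotalSpace.mk x (l : L x)) : TotTangent V x (l : L x)))
      ∈ AtiyahFiber V L x
  then ⟨_, hst⟩ else 0

/-- The coordinate on the fibre `L x` given by the preferred trivialization at `x`. -/
def fiberCoord (x : M) : L x ≃L[ℂ] ℂ :=
  (trivializationAt ℂ L x).continuousLinearEquivAt ℂ x (FiberBundle.mem_baseSet_trivializationAt' x)

/-- A nonzero point of `L x`. -/
def basePoint (x : M) : {l : L x // l ≠ 0} :=
  ⟨(fiberCoord x).symm 1, by simp⟩

/-- The projection `ρ : E → TM`, induced by the differential of the projection `L \ 0 → M`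
(it does not depend on the point of `L x \ {0}` at which it is computed, see `anchor_eq`). -/
def anchor (x : M) : AtiyahFiber V L x →ₗ[ℂ] TangentSpace 𝓘(ℂ, V) x :=
  (mfderiv (𝓘(ℂ, V).prod 𝓘(ℂ, ℂ)) 𝓘(ℂ, V) (TotalSpace.proj : TotalSpace ℂ L → M)
    (TotalSpace.mk x (basePoint (L := L) x : L x))).toLinearMap ∘ₗ
  (LinearMap.proj (R := ℂ) (φ := fun l : {l : L x // l ≠ 0} ↦ TotTangent V x (l : L x))
    (basePoint (L := L) x)) ∘ₗ (AtiyahFiber V L x).subtype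

variable (V) in
/-- The vertical lift at `l` of `v ∈ L x`: the velocity at `0` of the curve `t ↦ l + t v`, computed
with the help of the linear coordinate on `L x`. -/
def verticalLift (x : M) (l : L x) : L x →L[ℂ] TotTangent V x l :=
  ContinuousLinearMap.comp (M₂ := ℂ)
    (mfderiv 𝓘(ℂ, ℂ) (𝓘(ℂ, V).prod 𝓘(ℂ, ℂ))
      (fun z : ℂ ↦ (TotalSpace.mk x (l + (fiberCoord x).symm z) : TotalSpace ℂ L)) 0)
    (fiberCoord (L := L) x).toContinuousLinearMap

variable (V) in
/-- The infinitesimal generator of the action of `ℂ \ {0}` on `L`, at the point `l`: the velocity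
at `0` of the curve `t ↦ exp t • l`. -/
def generatorAt (x : M) (l : L x) : TotTangent V x l :=
  mfderiv 𝓘(ℂ, ℂ) (𝓘(ℂ, V).prod 𝓘(ℂ, ℂ))
    (fun t : ℂ ↦ (TotalSpace.mk x (Complex.exp t • l) : TotalSpace ℂ L)) 0 (1 : ℂ)

/-- A local section of `L` (constant in the preferred trivialization at `x`, and `0` outside its
domain) whose value at `x` is `l`. -/
def localSection (x : M) (l : L x) (y : M) : L y :=
  (trivializationAt ℂ L x).symmL ℂ y (fiberCoord x l)

variable (V) in
/-- The differential at `x` of `localSection x l`. -/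
def dLocalSection (x : M) (l : L x) : TangentSpace 𝓘(ℂ, V) x →L[ℂ] TotTangent V x l :=
  mfderiv 𝓘(ℂ, V) (𝓘(ℂ, V).prod 𝓘(ℂ, ℂ))
    (fun y : M ↦ (TotalSpace.mk y (localSection x l y) : TotalSpace ℂ L)) x

/-- The horizontal lift at `l` of `X ∈ T_x M`, with respect to the connection `D` on `L`:
`ds(X)` minus the vertical lift of `D_X s`, where `s` is a local section of `L` with `s(x) = l`
(the result does not depend on the choice of `s`). -/
def horizontalLiftAt (D : CovariantDerivative 𝓘(ℂ, V) ℂ L) (x : M) (l : L x) :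
    TangentSpace 𝓘(ℂ, V) x →L[ℂ] TotTangent V x l :=
  dLocalSection V x l - verticalLift V x l ∘L D (localSection x l) x

lemma contMDiff_scale (a : ℂ) :
    ContMDiff (𝓘(ℂ, V).prod 𝓘(ℂ, ℂ)) (𝓘(ℂ, V).prod 𝓘(ℂ, ℂ)) ω (scale (L := L) a) := by
  intro p
  have hid : ContMDiffAt (𝓘(ℂ, V).prod 𝓘(ℂ, ℂ)) (𝓘(ℂ, V).prod 𝓘(ℂ, ℂ)) ω
    (fun q : TotalSpace ℂ L ↦ q) p := contMDiffAt_id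
  rw [Bundle.contMDiffAt_totalSpace] at hid ⊢
  refine ⟨hid.1, ?_⟩
  have h2 := (contMDiffAt_const (c := a)).mul hid.2
  refine h2.congr_of_eventuallyEq ?_
  have hopen : TotalSpace.proj ⁻¹' (trivializationAt ℂ L p.1).baseSet ∈ 𝓝 p :=
    ((trivializationAt ℂ L p.1).open_baseSet.preimage
      (FiberBundle.continuous_proj ℂ L)).mem_nhds (FiberBundle.mem_baseSet_trivializationAt' p.1)
  filter_upwards [hopen] with q hq
  have := ((trivializationAt ℂ L p.1).linear ℂ hq).map_smul a q.2
  simpa [scale] using this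

lemma hasMFDerivAt_scale (a : ℂ) (x : M) (l : L x) (p : TotalSpace ℂ L)
    (hp : p = TotalSpace.mk x l) :
    HasMFDerivAt (𝓘(ℂ, V).prod 𝓘(ℂ, ℂ)) (𝓘(ℂ, V).prod 𝓘(ℂ, ℂ)) (scale (L := L) a) p
      (dscale V a x l : V × ℂ →L[ℂ] V × ℂ) := by
  subst hp
  exact ((contMDiff_scale a _).mdifferentiableAt (by simp)).hasMFDerivAt

lemma mdifferentiableAt_fiberCurve (x : M) (f : ℂ → L x) (z : ℂ)
    (hf : DifferentiableAt ℂ (fun w ↦ fiberCoord x (f w)) z) :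
    MDifferentiableAt 𝓘(ℂ, ℂ) (𝓘(ℂ, V).prod 𝓘(ℂ, ℂ))
      (fun w : ℂ ↦ (TotalSpace.mk x (f w) : TotalSpace ℂ L)) z := by
  rw [mdifferentiableAt_totalSpace]
  exact ⟨mdifferentiableAt_const, hf.mdifferentiableAt⟩

lemma dscale_generatorAt (a : ℂ) (x : M) (l : L x) :
    dscale V a x l (generatorAt V x l) = generatorAt V x (a • l) := by
  have hc : MDifferentiableAt 𝓘(ℂ, ℂ) (𝓘(ℂ, V).prod 𝓘(ℂ, ℂ))
      (fun t : ℂ ↦ (TotalSpace.mk x (Complex.exp t • l) : TotalSpace ℂ L)) 0 := by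
    apply mdifferentiableAt_fiberCurve
    simp only [map_smul, smul_eq_mul]
    fun_prop
  have hcomp := HasMFDerivAt.comp (0 : ℂ) (hasMFDerivAt_scale (V := V) a x l _ (by simp))
    hc.hasMFDerivAt
  have hfun : scale (L := L) a ∘ (fun t : ℂ ↦ (TotalSpace.mk x (Complex.exp t • l) : TotalSpace ℂ L))
      = fun t : ℂ ↦ TotalSpace.mk x (Complex.exp t • a • l) := by
    funext t
    simp [scale, smul_comm a]
  rw [hfun] at hcomp
  exact (congrArg (fun f : ℂ →L[ℂ] V × ℂ ↦ f 1) hcomp.mfderiv).symm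

lemma verticalLift_apply (x : M) (l v : L x) :
    verticalLift V x l v = (show ℂ →L[ℂ] V × ℂ from mfderiv 𝓘(ℂ, ℂ) (𝓘(ℂ, V).prod 𝓘(ℂ, ℂ))
      (fun z : ℂ ↦ (TotalSpace.mk x (l + (fiberCoord x).symm z) : TotalSpace ℂ L)) 0)
        (fiberCoord x v) := rfl

lemma dscale_verticalLift (a : ℂ) (x : M) (l v : L x) :
    dscale V a x l (verticalLift V x l v) = verticalLift V x (a • l) (a • v) := by
  have hc (l : L x) (w : ℂ) : MDifferentiableAt 𝓘(ℂ, ℂ) (𝓘(ℂ, V).prod 𝓘(ℂ, ℂ))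
      (fun z : ℂ ↦ (TotalSpace.mk x (l + (fiberCoord x).symm z) : TotalSpace ℂ L)) w := by
    apply mdifferentiableAt_fiberCurve
    simp only [map_add, ContinuousLinearEquiv.apply_symm_apply]
    fun_prop
  have hcomp := HasMFDerivAt.comp (0 : ℂ) (hasMFDerivAt_scale (V := V) a x l _ (by simp))
    (hc l 0).hasMFDerivAt
  have hm : HasMFDerivAt 𝓘(ℂ, ℂ) 𝓘(ℂ, ℂ) (fun z : ℂ ↦ a * z) 0
      (show ℂ →L[ℂ] ℂ from a • ContinuousLinearMap.id ℂ ℂ) :=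
    ((hasFDerivAt_id (0 : ℂ)).const_mul a).hasMFDerivAt
  have hv : ∀ w : ℂ, w = 0 → HasMFDerivAt 𝓘(ℂ, ℂ) (𝓘(ℂ, V).prod 𝓘(ℂ, ℂ))
      (fun z : ℂ ↦ (TotalSpace.mk x (a • l + (fiberCoord x).symm z) : TotalSpace ℂ L)) w
      (show ℂ →L[ℂ] V × ℂ from mfderiv 𝓘(ℂ, ℂ) (𝓘(ℂ, V).prod 𝓘(ℂ, ℂ))
      (fun z : ℂ ↦ (TotalSpace.mk x (a • l + (fiberCoord x).symm z) : TotalSpace ℂ L)) 0) := by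
    intro w hw
    subst hw
    exact (hc _ _).hasMFDerivAt
  have hcomp' := HasMFDerivAt.comp (0 : ℂ) (hv (a * 0) (mul_zero a)) hm
  have hfun : scale (L := L) a ∘
      (fun z : ℂ ↦ (TotalSpace.mk x (l + (fiberCoord x).symm z) : TotalSpace ℂ L))
      = (fun z : ℂ ↦ (TotalSpace.mk x (a • l + (fiberCoord x).symm z) : TotalSpace ℂ L)) ∘
        (fun z : ℂ ↦ a * z) := by
    funext z
    simp only [scale, Function.comp_apply, smul_add]
    rw [← smul_eq_mul a z, map_smul]
  rw [hfun] at hcomp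
  have h1 := hasMFDerivAt_unique hcomp hcomp'
  have h3 : (a • ContinuousLinearMap.id ℂ ℂ) (fiberCoord x v) = fiberCoord x (a • v) := by simp
  have h2 := congrArg (fun f : ℂ →L[ℂ] V × ℂ ↦ f (fiberCoord x v)) h1
  rw [verticalLift_apply, verticalLift_apply, ← h3]
  exact h2

lemma localSection_self (x : M) (l : L x) : localSection x l x = l := by
  have hx : x ∈ (trivializationAt ℂ L x).baseSet := FiberBundle.mem_baseSet_trivializationAt' x
  have h1 := (fiberCoord x).symm_apply_apply l
  rwa [fiberCoord, Trivialization.symm_continuousLinearEquivAt_eq] at h1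

lemma localSection_smul (a : ℂ) (x : M) (l : L x) :
    localSection x (a • l) = a • localSection x l := by
  funext y
  rw [Pi.smul_apply, localSection, localSection, map_smul, map_smul]

lemma mdifferentiableAt_localSection (x : M) (l : L x) :
    MDifferentiableAt 𝓘(ℂ, V) (𝓘(ℂ, V).prod 𝓘(ℂ, ℂ))
      (fun y : M ↦ (TotalSpace.mk y (localSection x l y) : TotalSpace ℂ L)) x := by
  refine (FiberBundle.mdifferentiableAt_extend 𝓘(ℂ, V) ℂ l).congr_of_eventuallyEq ?_
  filter_upwards [(trivializationAt ℂ L x).open_baseSet.mem_nhds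
    (FiberBundle.mem_baseSet_trivializationAt' x)] with y hy
  have h1 : localSection x l y = FiberBundle.extend ℂ l y :=
    Trivialization.symmL_apply _ hy _
  rw [h1]

lemma dscale_horizontalLiftAt (D : CovariantDerivative 𝓘(ℂ, V) ℂ L) (a : ℂ) (x : M) (l : L x)
    (X : TangentSpace 𝓘(ℂ, V) x) :
    dscale V a x l (horizontalLiftAt D x l X) = horizontalLiftAt D x (a • l) X := by
  have hcomp := HasMFDerivAt.comp x (hasMFDerivAt_scale (V := V) a x l _
    (by rw [localSection_self])) (mdifferentiableAt_localSection (V := V) x l).hasMFDerivAt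
  have hfun : scale (L := L) a ∘
      (fun y : M ↦ (TotalSpace.mk y (localSection x l y) : TotalSpace ℂ L))
      = fun y : M ↦ TotalSpace.mk y (localSection x (a • l) y) := by
    rw [localSection_smul]
    rfl
  rw [hfun] at hcomp
  have h1 := congrArg (fun f : V →L[ℂ] V × ℂ ↦ f X) hcomp.mfderiv
  have h2 : D (localSection x (a • l)) x = a • D (localSection x l) x := by
    rw [localSection_smul]
    exact D.isCovariantDerivativeOnUniv.smul_const a (mdifferentiableAt_localSection x l)
  have h3 := dscale_verticalLift (V := V) a x l (D (localSection x l) x X)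
  have h4 := map_sub (dscale V a x l)
    (dLocalSection V x l X)
    (verticalLift V x l (D (localSection x l) x X))
  refine Eq.trans h4 ?_
  have h5 : a • D (localSection x l) x X = D (localSection x (a • l)) x X := by
    rw [h2]; rfl
  rw [h3, h5]
  exact congrArg (fun w : V × ℂ ↦ w -
    (show V × ℂ from verticalLift V x (a • l) (D (localSection x (a • l)) x X))) h1.symm

lemma hasMFDerivAt_proj (x : M) (l : L x) (p : TotalSpace ℂ L)
    (hp : p = TotalSpace.mk x l) :
    HasMFDerivAt (𝓘(ℂ, V).prod 𝓘(ℂ, ℂ)) 𝓘(ℂ, V) (TotalSpace.proj : TotalSpace ℂ L → M) p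
      (show V × ℂ →L[ℂ] V from mfderiv (𝓘(ℂ, V).prod 𝓘(ℂ, ℂ)) 𝓘(ℂ, V)
        (TotalSpace.proj : TotalSpace ℂ L → M) (TotalSpace.mk x l)) := by
  subst hp
  exact ((Bundle.contMDiff_proj (n := ω) L _).mdifferentiableAt (by simp)).hasMFDerivAt

lemma dproj_verticalLift (x : M) (l v : L x) :
    mfderiv (𝓘(ℂ, V).prod 𝓘(ℂ, ℂ)) 𝓘(ℂ, V) (TotalSpace.proj : TotalSpace ℂ L → M)
      (TotalSpace.mk x l) (verticalLift V x l v) = 0 := by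
  have hc : MDifferentiableAt 𝓘(ℂ, ℂ) (𝓘(ℂ, V).prod 𝓘(ℂ, ℂ))
      (fun z : ℂ ↦ (TotalSpace.mk x (l + (fiberCoord x).symm z) : TotalSpace ℂ L)) 0 := by
    apply mdifferentiableAt_fiberCurve
    simp only [map_add, ContinuousLinearEquiv.apply_symm_apply]
    fun_prop
  have hcomp := HasMFDerivAt.comp (0 : ℂ) (hasMFDerivAt_proj (V := V) x l _ (by simp))
    hc.hasMFDerivAt
  have h1 := hcomp.mfderiv.symm.trans (hasMFDerivAt_const (I := 𝓘(ℂ, ℂ)) x (0 : ℂ)).mfderiv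
  exact congrArg (fun f : ℂ →L[ℂ] V ↦ f (fiberCoord x v)) h1

lemma dproj_horizontalLiftAt (D : CovariantDerivative 𝓘(ℂ, V) ℂ L) (x : M) (l : L x)
    (X : TangentSpace 𝓘(ℂ, V) x) :
    mfderiv (𝓘(ℂ, V).prod 𝓘(ℂ, ℂ)) 𝓘(ℂ, V) (TotalSpace.proj : TotalSpace ℂ L → M)
      (TotalSpace.mk x l) (horizontalLiftAt D x l X) = X := by
  have hcomp := HasMFDerivAt.comp x (hasMFDerivAt_proj (V := V) x l _
    (by rw [localSection_self])) (mdifferentiableAt_localSection (V := V) x l).hasMFDerivAt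
  have h1 := hcomp.mfderiv.symm.trans (hasMFDerivAt_id (I := 𝓘(ℂ, V)) x).mfderiv
  have h2 := congrArg (fun f : V →L[ℂ] V ↦ f X) h1
  have h4 := map_sub (mfderiv (𝓘(ℂ, V).prod 𝓘(ℂ, ℂ)) 𝓘(ℂ, V)
      (TotalSpace.proj : TotalSpace ℂ L → M) (TotalSpace.mk x l))
    (dLocalSection V x l X)
    (verticalLift V x l (D (localSection x l) x X))
  refine Eq.trans h4 ?_
  rw [dproj_verticalLift]
  refine Eq.trans (sub_zero _) ?_
  exact h2

lemma anchor_eq (x : M) (Z : AtiyahFiber V L x) (l : {l : L x // l ≠ 0}) :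
    anchor x Z = mfderiv (𝓘(ℂ, V).prod 𝓘(ℂ, ℂ)) 𝓘(ℂ, V) (TotalSpace.proj : TotalSpace ℂ L → M)
      (TotalSpace.mk x (l : L x)) (Z.1 l) := by
  obtain ⟨l, hl⟩ := l
  have hcl : fiberCoord x l ≠ 0 := by simpa using hl
  obtain ⟨a, ha⟩ : ∃ a : ℂˣ, (a : ℂ) • ((basePoint x).1 : L x) = l :=
    ⟨Units.mk0 _ hcl, by simp [basePoint, ← map_smul]⟩
  subst ha
  have hZ := Z.2 a (basePoint x)
  rw [← hZ]
  have hcomp := HasMFDerivAt.comp (TotalSpace.mk x (basePoint (L := L) x).1)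
    (hasMFDerivAt_proj (V := V) x ((a : ℂ) • (basePoint (L := L) x).1) _ rfl)
    (hasMFDerivAt_scale (V := V) (a : ℂ) x (basePoint (L := L) x).1 _ rfl)
  exact congrArg (fun f : V × ℂ →L[ℂ] V ↦ f (Z.1 (basePoint x))) hcomp.mfderiv

lemma toField_scale (s : AtiyahSection V L) (a : ℂˣ) (p : TotalSpace ℂ L) :
    dscale V (a : ℂ) p.1 p.2 (toField s p) = toField s (scale (a : ℂ) p) := by
  by_cases hp : p.2 = 0
  · have h1 : toField s p = 0 := dif_neg (by simpa using hp)
    have h2 : toField s (scale (a : ℂ) p) = 0 := dif_neg (by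
      rw [not_not]
      exact (congrArg (fun v : L p.1 ↦ (a : ℂ) • v) hp).trans (smul_zero (A := L p.1) (a : ℂ)))
    rw [h1, h2]
    exact map_zero _
  · have hp' : (scale (a : ℂ) p).2 ≠ 0 := smul_ne_zero a.ne_zero hp
    have h1 : toField s p = (s p.1).1 ⟨p.2, hp⟩ := dif_pos hp
    have h2 : toField s (scale (a : ℂ) p) = (s p.1).1 ⟨(a : ℂ) • p.2, hp'⟩ := dif_pos hp'
    rw [h1, h2]
    exact (s p.1).2 a ⟨p.2, hp⟩

lemma scale_inv_scale (a : ℂˣ) (p : TotalSpace ℂ L) :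
    scale ((a⁻¹ : ℂˣ) : ℂ) (scale (a : ℂ) p) = p := by
  have h : ((a⁻¹ : ℂˣ) : ℂ) • (a : ℂ) • p.2 = p.2 := by
    rw [smul_smul, Units.inv_mul, one_smul]
  exact congrArg (fun v ↦ (TotalSpace.mk p.1 v : TotalSpace ℂ L)) h

lemma isInvertible_dscale (a : ℂˣ) (x : M) (l : L x) :
    (dscale V (a : ℂ) x l).IsInvertible := by
  have h (b : ℂˣ) (m : L x) (p : TotalSpace ℂ L) (hp : p = TotalSpace.mk x m) :=
    hasMFDerivAt_scale (V := V) (b : ℂ) x m p hp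
  have hid (b : ℂˣ) : scale (L := L) ((b⁻¹ : ℂˣ) : ℂ) ∘ scale (L := L) (b : ℂ) = id :=
    funext fun p ↦ scale_inv_scale b p
  have h1 := HasMFDerivAt.comp (TotalSpace.mk x l) (h a⁻¹ ((a : ℂ) • l) _ rfl) (h a l _ rfl)
  have h2 := HasMFDerivAt.comp (TotalSpace.mk x ((a : ℂ) • l))
    (h a l _ (scale_inv_scale a (TotalSpace.mk x l))) (h a⁻¹ ((a : ℂ) • l) _ rfl)
  rw [hid a] at h1
  have hid' := hid a⁻¹
  rw [inv_inv] at hid'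
  rw [hid'] at h2
  have k1 := hasMFDerivAt_unique h1 (hasMFDerivAt_id _)
  have k2 := hasMFDerivAt_unique h2 (hasMFDerivAt_id _)
  exact ContinuousLinearMap.IsInvertible.of_inverse
    (g := (show V × ℂ →L[ℂ] V × ℂ from dscale V ((a⁻¹ : ℂˣ) : ℂ) x ((a : ℂ) • l))) k2 k1

lemma mpullback_scale_toField (s : AtiyahSection V L) (a : ℂˣ) :
    VectorField.mpullback (𝓘(ℂ, V).prod 𝓘(ℂ, ℂ)) (𝓘(ℂ, V).prod 𝓘(ℂ, ℂ)) (scale (L := L) (a : ℂ))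
      (toField s) = toField s := by
  funext p
  have h := (isInvertible_dscale (V := V) a p.1 p.2).inverse_apply_self (toField s p)
  rw [toField_scale] at h
  exact h

/-- The Lie bracket of the invariant vector fields given by two differentiable sections of `E` is
invariant. -/
lemma dscale_mlieBracket [CompleteSpace V] (s t : AtiyahSection V L) (x : M)
    (hs : s.DiffAt x) (ht : t.DiffAt x) :
    (fun l : {l : L x // l ≠ 0} ↦ (VectorField.mlieBracket (𝓘(ℂ, V).prod 𝓘(ℂ, ℂ))
      (toField s) (toField t) (TotalSpace.mk x (l : L x)) : TotTangent V x (l : L x)))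
      ∈ AtiyahFiber V L x := by
  intro a l
  have hne : (a : ℂ) • (l : L x) ≠ 0 := smul_ne_zero a.ne_zero l.2
  have h := VectorField.mpullback_mlieBracket (n := ω) (x₀ := (TotalSpace.mk x (l : L x)))
    (f := scale (L := L) (a : ℂ)) (hs _ hne) (ht _ hne) (contMDiff_scale (a : ℂ) _) (by simp)
  rw [mpullback_scale_toField, mpullback_scale_toField] at h
  have h2 := (isInvertible_dscale (V := V) a x (l : L x)).self_apply_inverse
    (show TotTangent V x ((a : ℂ) • (l : L x)) from
      VectorField.mlieBracket (𝓘(ℂ, V).prod 𝓘(ℂ, ℂ)) (toField s) (toField t)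
      (TotalSpace.mk x ((a : ℂ) • (l : L x))))
  exact (congrArg (dscale V (a : ℂ) x (l : L x)) h.symm).trans h2

/-- The section of `E` given by the infinitesimal generator of the action of `ℂ \ {0}` on `L`. -/
def generator (x : M) : AtiyahFiber V L x :=
  ⟨fun l ↦ generatorAt V x (l : L x), fun a l ↦ dscale_generatorAt (a : ℂ) x (l : L x)⟩

/-- The horizontal lift `TM → E` determined by the connection `D` on `L`. -/
def horizontal (D : CovariantDerivative 𝓘(ℂ, V) ℂ L) (x : M) :
    TangentSpace 𝓘(ℂ, V) x →ₗ[ℂ] AtiyahFiber V L x where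
  toFun X := ⟨fun l ↦ horizontalLiftAt D x (l : L x) X,
    fun a l ↦ dscale_horizontalLiftAt D (a : ℂ) x (l : L x) X⟩
  map_add' X Y := Subtype.ext (funext fun l ↦ map_add (horizontalLiftAt D x (l : L x)) X Y)
  map_smul' c X := Subtype.ext (funext fun l ↦ map_smul (horizontalLiftAt D x (l : L x)) c X)

/-- The section `𝟏` of `E`: the nowhere zero function `u` on `M` is such that `u 𝟏` is the
infinitesimal generator. Together with the horizontal lift it gives the isomorphism
`TM ⊕ ℂ = E`, `(X, c) ↦ X + c 𝟏`. -/
def unitSection (u : M → ℂ) : AtiyahSection V L := fun x ↦ (u x)⁻¹ • generator x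

lemma anchor_horizontal (D : CovariantDerivative 𝓘(ℂ, V) ℂ L) (x : M)
    (X : TangentSpace 𝓘(ℂ, V) x) : anchor x (horizontal D x X) = X :=
  dproj_horizontalLiftAt D x _ X

/-- A section of `TM` is differentiable at `x`. -/
def VectorFieldDiffAt (X : ∀ x : M, TangentSpace 𝓘(ℂ, V) x) (x : M) : Prop :=
  MDifferentiableAt 𝓘(ℂ, V) 𝓘(ℂ, V).tangent (fun y ↦ (⟨y, X y⟩ : TangentBundle 𝓘(ℂ, V) M)) x

variable (V L) in
/-- A `ρ`-connection on the vector bundle `W` over `M`, where `ρ = anchor : E → TM`: to a section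
`σ` of `W` and `e ∈ E_x` it associates `∇_e σ ∈ W_x`, linearly in `e`, additively in `σ`, and
satisfying the Leibniz rule `∇_e (f σ) = f ∇_e σ + ρ(e)(f) σ`. Here, `DiffAt σ x` means that `σ` is
differentiable at `x`. (Sections are arbitrary maps, the conditions being imposed where they
are differentiable; in particular, local sections may be extended arbitrarily outside their domain,
as the axioms imply that `∇_e σ` depends only on the germ of `σ`.) -/
structure RhoConnection (W : M → Type*) [∀ x, AddCommGroup (W x)] [∀ x, Module ℂ (W x)]
    (DiffAt : (∀ x, W x) → M → Prop) where
  /-- `toFun σ x e` is `∇_e σ`. -/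
  toFun : (∀ x, W x) → ∀ x, AtiyahFiber V L x →ₗ[ℂ] W x
  add : ∀ (σ τ : ∀ x, W x) (x : M), DiffAt σ x → DiffAt τ x →
    ∀ e, toFun (σ + τ) x e = toFun σ x e + toFun τ x e
  leibniz : ∀ (f : M → ℂ) (σ : ∀ x, W x) (x : M), MDifferentiableAt 𝓘(ℂ, V) 𝓘(ℂ, ℂ) f x →
    DiffAt σ x → ∀ e, toFun (fun y ↦ f y • σ y) x e =
      f x • toFun σ x e + mvfderiv 𝓘(ℂ, V) f x (anchor x e) • σ x

variable (V L) in
/-- The `ρ`-connections on `TM`. -/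
abbrev RhoConnectionTM : Type _ :=
  RhoConnection V L (fun x : M ↦ TangentSpace 𝓘(ℂ, V) x) VectorFieldDiffAt

variable (V L) in
/-- The `ρ`-connections on `E`. -/
abbrev RhoConnectionE : Type _ :=
  RhoConnection V L (fun x : M ↦ AtiyahFiber V L x) AtiyahSection.DiffAt

/-- The torsion of a `ρ`-connection on `E`, evaluated on sections of `E`. -/
def rhoTorsion (nab : RhoConnectionE V L) (s t : AtiyahSection V L) (x : M) : AtiyahFiber V L x :=
  nab.toFun t x (s x) - nab.toFun s x (t x) - atiyahBracket s t x

/-- The connection on `TM` given by a `ρ`-connection on `TM` and the connection `D` on `L`: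
`∇_X Y` is `∇_e Y`, where `e ∈ E` is the horizontal lift of `X`. -/
def inducedConnection [FiniteDimensional ℂ V] (D : CovariantDerivative 𝓘(ℂ, V) ℂ L)
    (nab : RhoConnectionTM V L) :
    CovariantDerivative 𝓘(ℂ, V) V (fun x : M ↦ TangentSpace 𝓘(ℂ, V) x) where
  toFun Y x := (LinearMap.toContinuousLinearMap (nab.toFun Y x ∘ₗ horizontal D x : V →ₗ[ℂ] V) : V →L[ℂ] V)
  isCovariantDerivativeOnUniv :=
    { add := by
        intro σ τ x hσ hτ _
        ext X
        exact nab.add σ τ x hσ hτ (horizontal D x X)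
      leibniz := by
        intro σ f x hσ hf _
        ext X'
        let X : TangentSpace 𝓘(ℂ, V) x := X'
        have h := nab.leibniz f σ x hf hσ (horizontal D x X)
        rw [anchor_horizontal] at h
        exact h }

/-- The connection `D` on `L` is holomorphic: over each open set, it maps holomorphic sections of
`L` to holomorphic sections of `Hom(TM, L)`. -/
def IsHolomorphicConnection (D : CovariantDerivative 𝓘(ℂ, V) ℂ L) : Prop :=
  ∀ U : Set M, IsOpen U → ContMDiffCovariantDerivativeOn ℂ ω D.toFun U

/-- `D_X D_Y σ - D_Y D_X σ - D_[X, Y] σ`. -/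
def curvatureOperator (D : CovariantDerivative 𝓘(ℂ, V) ℂ L)
    (X Y : ∀ x : M, TangentSpace 𝓘(ℂ, V) x) (σ : ∀ x, L x) (x : M) : L x :=
  D (fun y ↦ D σ y (Y y)) x (X x) - D (fun y ↦ D σ y (X y)) x (Y x)
    - D σ x (VectorField.mlieBracket 𝓘(ℂ, V) X Y x)

/-- The curvature form `Ω` of the connection `D` on the line bundle `L`, characterised by
`Ω(X, Y) σ = D_X D_Y σ - D_Y D_X σ - D_[X, Y] σ`. It is computed by extending `X` and `Y` to
holomorphic vector fields around `x`, and by taking `σ` to be a holomorphic section of `L` around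
`x` whose value at `x` has coordinate `1`. -/
def curvatureForm (D : CovariantDerivative 𝓘(ℂ, V) ℂ L) (x : M)
    (X Y : TangentSpace 𝓘(ℂ, V) x) : ℂ :=
  fiberCoord x (curvatureOperator D (FiberBundle.extend V X) (FiberBundle.extend V Y)
    (localSection x ((fiberCoord x).symm 1)) x)

variable (V M) in
/-- A holomorphic Riemannian metric on `M`. -/
structure HolomorphicMetric where
  /-- The bilinear form on each tangent space. -/
  inner (x : M) : TangentSpace 𝓘(ℂ, V) x →L[ℂ] TangentSpace 𝓘(ℂ, V) x →L[ℂ] ℂ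
  symm (x : M) (X Y : TangentSpace 𝓘(ℂ, V) x) : inner x X Y = inner x Y X
  nondegenerate (x : M) (X : TangentSpace 𝓘(ℂ, V) x) : (∀ Y, inner x X Y = 0) → X = 0
  contMDiff : ContMDiff 𝓘(ℂ, V) (𝓘(ℂ, V).prod 𝓘(ℂ, V →L[ℂ] V →L[ℂ] ℂ)) ω
    (fun x ↦ TotalSpace.mk' (V →L[ℂ] V →L[ℂ] ℂ) x (inner x))

/-- The relations between the `ρ`-connection `nabE` on `E`, the `ρ`-connection `nab` on `TM`, and the
section `γ` of `Hom(E, TM)`, through the section `h` of `Hom(TM, End(TM))` and the metric `g`.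
Vector fields on `M` are seen as sections of `E` through the horizontal lift. -/
structure IsTildeConnection (D : CovariantDerivative 𝓘(ℂ, V) ℂ L) (u : M → ℂ)
    (g : HolomorphicMetric V M)
    (h : ∀ x : M, TangentSpace 𝓘(ℂ, V) x →ₗ[ℂ]
      TangentSpace 𝓘(ℂ, V) x →ₗ[ℂ] TangentSpace 𝓘(ℂ, V) x)
    (γ : ∀ x : M, AtiyahFiber V L x →ₗ[ℂ] TangentSpace 𝓘(ℂ, V) x)
    (nab : RhoConnectionTM V L) (nabE : RhoConnectionE V L) : Prop where
  horizontal_horizontal : ∀ (x : M) (X : TangentSpace 𝓘(ℂ, V) x)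
    (Y : ∀ y : M, TangentSpace 𝓘(ℂ, V) y), VectorFieldDiffAt Y x →
    nabE.toFun (fun y ↦ horizontal D y (Y y)) x (horizontal D x X) =
      horizontal D x (nab.toFun Y x (horizontal D x X) + h x (γ x (horizontal D x X)) (Y x))
        - g.inner x (γ x (horizontal D x X)) (Y x) • unitSection u x
  horizontal_unit : ∀ (x : M) (X : TangentSpace 𝓘(ℂ, V) x),
    nabE.toFun (unitSection u) x (horizontal D x X) =
      horizontal D x (γ x (horizontal D x X))
  unit_horizontal : ∀ (x : M) (X : ∀ y : M, TangentSpace 𝓘(ℂ, V) y), VectorFieldDiffAt X x →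
    nabE.toFun (fun y ↦ horizontal D y (X y)) x (unitSection u x) =
      horizontal D x (nab.toFun X x (unitSection u x) + h x (γ x (unitSection u x)) (X x))
        - g.inner x (γ x (unitSection u x)) (X x) • unitSection u x
  unit_unit : ∀ x : M,
    nabE.toFun (unitSection u) x (unitSection u x) = horizontal D x (γ x (unitSection u x))

end Setting
end LineBundleAtiyah
end

open LineBundleAtiyah

/-! The torsion formulas follow by substitution from two brackets of sections of `E`: for horizontal
lifts, [X, Y] lifted minus Ω(X, Y) times the generator u𝟏; for X and 𝟏, the section -u⁻¹X(u)𝟏.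

Both brackets are computed at a point x, in the preferred chart of M and the preferred
trivialization of L at x, with fibre coordinate z. There an invariant vector field on L \ 0 is a
pair (X, c) of a vector field and a function on the base: its base component is X and its fibre
component is zc. In the bracket of (X, c) and (Y, d) the terms zcd cancel, which leaves ([X, Y],
X(d) - Y(c)); this is `hasCoords_atiyahBracket`. It rests on `mlieBracket_eq_chartRep`, which is
simple because the derivative of a preferred chart at its own base point is the identity.

Let θ be the connection form of L in the frame z = 1. The lift of X is (X, -θ(X)), the generator is
(0, 1) and 𝟏 is (0, u⁻¹). The first bracket thus produces -dθ(X, Y), and dθ = Ω by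
`curvatureForm_eq_dConnForm`; the second produces X(u⁻¹). Since coordinates determine an element of
the fibre of `E` at x (`HasCoords.ext`), both brackets are identified. -/

noncomputable section

set_option linter.unusedSectionVars false

/-! ### Lie brackets computed in the preferred chart at a point -/

namespace VectorField

variable {𝕜 : Type*} [NontriviallyNormedField 𝕜]
  {E : Type*} [NormedAddCommGroup E] [NormedSpace 𝕜 E]
  {H : Type*} [TopologicalSpace H] {I : ModelWithCorners 𝕜 E H}
  {M : Type*} [TopologicalSpace M] [ChartedSpace H M]

variable (I) in
/-- The expression of a vector field in the preferred chart at `p`. -/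
def chartRep (p : M) (V : ∀ q : M, TangentSpace I q) (q : M) : E :=
  mvfderiv I (extChartAt I p) q (V q)

variable [IsManifold I 1 M]

lemma mvfderiv_extChartAt_self (p : M) (v : TangentSpace I p) :
    mvfderiv I (extChartAt I p) p v = v := by
  have h := mfderiv_extChartAt_self (I := I) (x := p)
  exact congrArg (fun f : E →L[𝕜] E ↦ f v) h

lemma trivializationAt_snd_eq_chartRep (p q : M) (hq : q ∈ (chartAt H p).source)
    (V : ∀ q : M, TangentSpace I q) :
    (trivializationAt E (TangentSpace I : M → Type _) p
      (⟨q, V q⟩ : TangentBundle I M)).2 = chartRep I p V q := by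
  have h := TangentBundle.continuousLinearMapAt_trivializationAt (I := I) hq
  have h2 : (trivializationAt E (TangentSpace I : M → Type _) p).continuousLinearMapAt 𝕜 q (V q) =
    (trivializationAt E (TangentSpace I : M → Type _) p (⟨q, V q⟩ : TangentBundle I M)).2 := by
    rw [Trivialization.continuousLinearMapAt_apply, Trivialization.linearMapAt_apply, if_pos]
    simpa using hq
  rw [← h2, h]
  rfl

/-- A vector field is differentiable at `p` if and only if its expression in the preferred chart
is. -/
lemma mdifferentiableAt_iff_chartRep (p : M) (V : ∀ q : M, TangentSpace I q) :
    MDifferentiableAt I I.tangent (fun q ↦ (⟨q, V q⟩ : TangentBundle I M)) p ↔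
      MDifferentiableAt I 𝓘(𝕜, E) (chartRep I p V) p := by
  refine (mdifferentiableAt_section I V).trans ?_
  have h : (fun q ↦ (trivializationAt E (TangentSpace I : M → Type _) p
      (⟨q, V q⟩ : TangentBundle I M)).2) =ᶠ[𝓝 p] chartRep I p V := by
    filter_upwards [chart_source_mem_nhds H p] with q hq
    exact trivializationAt_snd_eq_chartRep p q hq V
  exact h.mdifferentiableAt_iff

/-- The Lie bracket on a manifold is defined through pullbacks by the inverse chart. As the
derivative of the inverse chart inverts that of the chart, such a pullback is the pushforward by the
chart. -/
lemma mpullbackWithin_extChartAt_symm (p : M) (V : ∀ q : M, TangentSpace I q) {z : E}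
    (hz : z ∈ (extChartAt I p).target) :
    mpullbackWithin 𝓘(𝕜, E) I (extChartAt I p).symm V (range I) z =
      chartRep I p V ((extChartAt I p).symm z) := by
  have h := mfderivWithin_extChartAt_symm_comp_mfderiv_extChartAt (I := I) hz
  exact (isInvertible_mfderivWithin_extChartAt_symm hz).inverse_apply_eq.2
    (congrArg (fun f : E →L[𝕜] E ↦ f (V ((extChartAt I p).symm z))) h).symm

/-- The Lie bracket of two vector fields in terms of their expressions in the preferred chart. -/
lemma mlieBracket_eq_chartRep (p : M) (V W : ∀ q : M, TangentSpace I q)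
    (hV : MDifferentiableAt I 𝓘(𝕜, E) (chartRep I p V) p)
    (hW : MDifferentiableAt I 𝓘(𝕜, E) (chartRep I p W) p) :
    mlieBracket I V W p =
      mvfderiv I (chartRep I p W) p (V p) - mvfderiv I (chartRep I p V) p (W p) := by
  have key (U : ∀ q : M, TangentSpace I q) (hU : MDifferentiableAt I 𝓘(𝕜, E) (chartRep I p U) p) :
      (fderivWithin 𝕜 (mpullbackWithin 𝓘(𝕜, E) I (extChartAt I p).symm U (range I) : E → E)
        ((extChartAt I p).symm ⁻¹' univ ∩ range I) (extChartAt I p p) : E →L[𝕜] E) =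
      mvfderiv I (chartRep I p U) p := by
    -- The manifold derivative of a vector-valued function is by definition that of its expression
    -- in the chart, and near the base point this expression is the pulled back field.
    refine Eq.trans ?_ hU.mvfderiv.symm
    rw [preimage_univ, univ_inter]
    refine Filter.EventuallyEq.fderivWithin_eq_of_mem ?_ (mem_range_self _)
    filter_upwards [extChartAt_target_mem_nhdsWithin (I := I) p] with z hz
    exact mpullbackWithin_extChartAt_symm p U hz
  have hval (U : ∀ q : M, TangentSpace I q) :
      mpullbackWithin 𝓘(𝕜, E) I (extChartAt I p).symm U (range I) (extChartAt I p p) = U p := by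
    refine (mpullbackWithin_extChartAt_symm p U (mem_extChartAt_target p)).trans ?_
    rw [extChartAt_to_inv]
    exact mvfderiv_extChartAt_self p (U p)
  have h1 : mlieBracket I V W p = (lieBracketWithin 𝕜
      (mpullbackWithin 𝓘(𝕜, E) I (extChartAt I p).symm V (range I))
      (mpullbackWithin 𝓘(𝕜, E) I (extChartAt I p).symm W (range I))
      ((extChartAt I p).symm ⁻¹' univ ∩ range I)) (extChartAt I p p) := by
    refine (mlieBracketWithin_apply (s := univ)).trans ?_
    -- The bracket in the chart is transported back by the inverse of the chart's derivative at p,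
    -- which is the identity.
    refine (isInvertible_mfderiv_extChartAt (mem_extChartAt_source p)).inverse_apply_eq.2 ?_
    exact (mvfderiv_extChartAt_self (I := I) p (_ : E)).symm
  refine h1.trans ?_
  have hd (U U' : ∀ q : M, TangentSpace I q)
      (hU : MDifferentiableAt I 𝓘(𝕜, E) (chartRep I p U) p) :=
    congr_arg₂ (fun (f : E →L[𝕜] E) (v : E) ↦ f v) (key U hU) (hval U')
  exact congr_arg₂ (fun v w : E ↦ v - w) (hd W V hW) (hd V W hV)

end VectorField

/-! ### Local coordinates on the total space of the line bundle -/

namespace LineBundleAtiyah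

section Coordinates

variable {V : Type*} [NormedAddCommGroup V] [NormedSpace ℂ V]
  {M : Type*} [TopologicalSpace M] [ChartedSpace V M] [IsManifold 𝓘(ℂ, V) ω M]
  {L : M → Type*} [TopologicalSpace (TotalSpace ℂ L)]
  [∀ x, AddCommGroup (L x)] [∀ x, Module ℂ (L x)] [∀ x, TopologicalSpace (L x)]
  [∀ x, IsTopologicalAddGroup (L x)] [∀ x, ContinuousSMul ℂ (L x)]
  [FiberBundle ℂ L] [VectorBundle ℂ ℂ L] [ContMDiffVectorBundle ω ℂ L 𝓘(ℂ, V)]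

lemma hasMFDerivAt_prodMk_space {𝕜 : Type*} [NontriviallyNormedField 𝕜]
    {E : Type*} [NormedAddCommGroup E] [NormedSpace 𝕜 E]
    {H : Type*} [TopologicalSpace H] {I : ModelWithCorners 𝕜 E H}
    {N : Type*} [TopologicalSpace N] [ChartedSpace H N]
    {F : Type*} [NormedAddCommGroup F] [NormedSpace 𝕜 F]
    {G : Type*} [NormedAddCommGroup G] [NormedSpace 𝕜 G]
    {f : N → F} {g : N → G} {q : N} {f' : E →L[𝕜] F} {g' : E →L[𝕜] G}
    (hf : HasMFDerivAt I 𝓘(𝕜, F) f q f') (hg : HasMFDerivAt I 𝓘(𝕜, G) g q g') :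
    HasMFDerivAt I 𝓘(𝕜, F × G) (fun q ↦ (f q, g q)) q (f'.prod g') :=
  ⟨hf.1.prodMk hg.1, hf.2.prodMk hg.2⟩

/-- The fibre coordinate on the total space of `L` given by the preferred trivialization at `x`. -/
def fiberVar (x : M) (q : TotalSpace ℂ L) : ℂ := (trivializationAt ℂ L x q).2

/-- The local frame of `L` given by the preferred trivialization at `x`. -/
def frame (x y : M) : L y := localSection x ((fiberCoord x).symm 1) y

lemma fiberVar_add {x y : M} (hy : y ∈ (trivializationAt ℂ L x).baseSet) (l m : L y) :
    fiberVar x (TotalSpace.mk y (l + m)) =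
      fiberVar x (TotalSpace.mk y l) + fiberVar x (TotalSpace.mk y m) :=
  ((trivializationAt ℂ L x).linear ℂ hy).map_add l m

lemma fiberVar_smul {x y : M} (hy : y ∈ (trivializationAt ℂ L x).baseSet) (a : ℂ) (l : L y) :
    fiberVar x (TotalSpace.mk y (a • l)) = a * fiberVar x (TotalSpace.mk y l) :=
  ((trivializationAt ℂ L x).linear ℂ hy).map_smul a l

lemma fiberVar_self (x : M) (l : L x) : fiberVar x (TotalSpace.mk x l) = fiberCoord x l :=
  rfl

lemma fiberVar_ne_zero {x : M} {l : L x} (hl : l ≠ 0) : fiberVar x (TotalSpace.mk x l) ≠ 0 := by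
  rw [fiberVar_self]
  simpa using hl

lemma fiberVar_frame {x y : M} (hy : y ∈ (trivializationAt ℂ L x).baseSet) :
    fiberVar x (TotalSpace.mk y (frame (L := L) x y)) = 1 := by
  rw [frame, localSection, ContinuousLinearEquiv.apply_symm_apply, fiberVar,
    Trivialization.symmL_apply _ hy, Trivialization.apply_mk_symm _ hy]

lemma fiberVar_smul_frame {x y : M} (hy : y ∈ (trivializationAt ℂ L x).baseSet) (l : L y) :
    fiberVar x (TotalSpace.mk y l) • frame x y = l := by
  have h := (trivializationAt ℂ L x).symm_apply_apply_mk hy l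
  rw [frame, localSection, ContinuousLinearEquiv.apply_symm_apply, ← map_smul, smul_eq_mul, mul_one,
    Trivialization.symmL_apply _ hy]
  exact h

lemma mdifferentiableAt_fiberVar {x : M} {q : TotalSpace ℂ L}
    (hq : q.proj ∈ (trivializationAt ℂ L x).baseSet) :
    MDifferentiableAt (𝓘(ℂ, V).prod 𝓘(ℂ, ℂ)) 𝓘(ℂ, ℂ) (fiberVar (L := L) x) q := by
  have : ContMDiffVectorBundle 1 ℂ L 𝓘(ℂ, V) := ContMDiffVectorBundle.of_le (n := ω) le_top
  exact (((trivializationAt ℂ L x).mdifferentiableAt_totalSpace_iff (IB := 𝓘(ℂ, V)) (fun q ↦ q)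
    ((trivializationAt ℂ L x).mem_source.2 hq)).1 mdifferentiableAt_id).2

/-- The point p is kept apart from the point (y, l) because the chain rule is applied along curves
and sections whose value at the base point, such as exp 0 • l, equals l only propositionally. -/
lemma hasMFDerivAt_fiberVar {x y : M} (hy : y ∈ (trivializationAt ℂ L x).baseSet) (l : L y)
    (p : TotalSpace ℂ L) (hp : p = TotalSpace.mk y l) :
    HasMFDerivAt (𝓘(ℂ, V).prod 𝓘(ℂ, ℂ)) 𝓘(ℂ, ℂ) (fiberVar (L := L) x) p
      (show V × ℂ →L[ℂ] ℂ from mvfderiv (𝓘(ℂ, V).prod 𝓘(ℂ, ℂ)) (fiberVar (L := L) x)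
        (TotalSpace.mk y l)) := by
  subst hp
  exact (mdifferentiableAt_fiberVar hy).hasMFDerivAt

lemma eventually_mem_chart_baseSet (x : M) : ∀ᶠ y in 𝓝 x,
    y ∈ (trivializationAt ℂ L x).baseSet ∧ y ∈ (chartAt V x).source :=
  Filter.Eventually.and ((trivializationAt ℂ L x).open_baseSet.mem_nhds
    (FiberBundle.mem_baseSet_trivializationAt' x)) (chart_source_mem_nhds V x)

/-- The differential of the preferred chart of the total space of `L`. -/
lemma mvfderiv_extChartAt_totalSpace (x : M) (l : L x) {q : TotalSpace ℂ L}
    (hq : q.proj ∈ (trivializationAt ℂ L x).baseSet) (hq' : q.proj ∈ (chartAt V x).source)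
    (w : TangentSpace (𝓘(ℂ, V).prod 𝓘(ℂ, ℂ)) q) :
    mvfderiv (𝓘(ℂ, V).prod 𝓘(ℂ, ℂ))
      (extChartAt (𝓘(ℂ, V).prod 𝓘(ℂ, ℂ)) (TotalSpace.mk x l : TotalSpace ℂ L)) q w =
      (mvfderiv 𝓘(ℂ, V) (extChartAt 𝓘(ℂ, V) x) q.proj
        (mfderiv (𝓘(ℂ, V).prod 𝓘(ℂ, ℂ)) 𝓘(ℂ, V) (TotalSpace.proj : TotalSpace ℂ L → M) q w),
        mvfderiv (𝓘(ℂ, V).prod 𝓘(ℂ, ℂ)) (fiberVar (L := L) x) q w) := by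
  have h1 : HasMFDerivAt (𝓘(ℂ, V).prod 𝓘(ℂ, ℂ)) 𝓘(ℂ, V)
      (extChartAt 𝓘(ℂ, V) x ∘ (TotalSpace.proj : TotalSpace ℂ L → M)) q _ :=
    HasMFDerivAt.comp q (mdifferentiableAt_extChartAt hq').hasMFDerivAt
      ((Bundle.contMDiff_proj (n := ω) L q).mdifferentiableAt (by simp)).hasMFDerivAt
  have h2 : HasMFDerivAt (𝓘(ℂ, V).prod 𝓘(ℂ, ℂ)) 𝓘(ℂ, ℂ) (fiberVar (L := L) x) q _ :=
    (mdifferentiableAt_fiberVar hq).hasMFDerivAt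
  have h3 := hasMFDerivAt_prodMk_space h1 h2
  have h4 : (extChartAt (𝓘(ℂ, V).prod 𝓘(ℂ, ℂ)) (TotalSpace.mk x l : TotalSpace ℂ L) :
      TotalSpace ℂ L → V × ℂ) =ᶠ[𝓝 q] fun q ↦ (extChartAt 𝓘(ℂ, V) x q.proj, fiberVar x q) := by
    have ho := ((trivializationAt ℂ L x).open_baseSet.preimage
      (FiberBundle.continuous_proj ℂ L)).mem_nhds hq
    filter_upwards [ho] with q hq
    rw [FiberBundle.extChartAt]
    simp only [PartialEquiv.trans_apply, PartialEquiv.prod_coe, PartialEquiv.refl_coe,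
      OpenPartialHomeomorph.coe_toPartialEquiv, Trivialization.coe_coe, id_eq]
    rw [Trivialization.coe_fst' _ hq]
    rfl
  have h5 := (h3.congr_of_eventuallyEq h4).mfderiv
  exact congrArg (fun f : V × ℂ →L[ℂ] V × ℂ ↦ f w) h5

/-- In the fibre coordinate z the flow is z ↦ exp(t) z, with velocity z at t = 0. -/
lemma mvfderiv_fiberVar_generatorAt {x y : M} (hy : y ∈ (trivializationAt ℂ L x).baseSet)
    (l : L y) :
    mvfderiv (𝓘(ℂ, V).prod 𝓘(ℂ, ℂ)) (fiberVar (L := L) x) (TotalSpace.mk y l)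
      (generatorAt V y l) = fiberVar x (TotalSpace.mk y l) := by
  have hc : MDifferentiableAt 𝓘(ℂ, ℂ) (𝓘(ℂ, V).prod 𝓘(ℂ, ℂ))
      (fun t : ℂ ↦ (TotalSpace.mk y (Complex.exp t • l) : TotalSpace ℂ L)) 0 := by
    apply mdifferentiableAt_fiberCurve
    simp only [map_smul, smul_eq_mul]
    fun_prop
  have hcomp := HasMFDerivAt.comp (0 : ℂ) (hasMFDerivAt_fiberVar (V := V) hy l _ (by simp))
    hc.hasMFDerivAt
  have hfun : fiberVar (L := L) x ∘
      (fun t : ℂ ↦ (TotalSpace.mk y (Complex.exp t • l) : TotalSpace ℂ L)) =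
      fun t : ℂ ↦ Complex.exp t * fiberVar x (TotalSpace.mk y l) := by
    funext t
    exact fiberVar_smul hy _ l
  rw [hfun] at hcomp
  have hd : HasMFDerivAt 𝓘(ℂ, ℂ) 𝓘(ℂ, ℂ)
      (fun t : ℂ ↦ Complex.exp t * fiberVar x (TotalSpace.mk y l)) 0 _ :=
    ((Complex.hasDerivAt_exp 0).mul_const
      (fiberVar x (TotalSpace.mk y l))).hasFDerivAt.hasMFDerivAt
  have h := congrArg (fun f : ℂ →L[ℂ] ℂ ↦ f 1) (hasMFDerivAt_unique hcomp hd)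
  refine Eq.trans h ?_
  simp

lemma dproj_generatorAt (y : M) (l : L y) :
    mfderiv (𝓘(ℂ, V).prod 𝓘(ℂ, ℂ)) 𝓘(ℂ, V) (TotalSpace.proj : TotalSpace ℂ L → M)
      (TotalSpace.mk y l) (generatorAt V y l) = 0 := by
  have hc : MDifferentiableAt 𝓘(ℂ, ℂ) (𝓘(ℂ, V).prod 𝓘(ℂ, ℂ))
      (fun t : ℂ ↦ (TotalSpace.mk y (Complex.exp t • l) : TotalSpace ℂ L)) 0 := by
    apply mdifferentiableAt_fiberCurve
    simp only [map_smul, smul_eq_mul]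
    fun_prop
  have hcomp := HasMFDerivAt.comp (0 : ℂ) (hasMFDerivAt_proj (V := V) y l _ (by simp))
    hc.hasMFDerivAt
  have h1 := hcomp.mfderiv.symm.trans (hasMFDerivAt_const (I := 𝓘(ℂ, ℂ)) y (0 : ℂ)).mfderiv
  exact congrArg (fun f : ℂ →L[ℂ] V ↦ f 1) h1

/-- The fibre coordinate is affine along the curve l + tv. Two coordinates on the fibre at y are
involved: the one preferred at y, in which the vertical lift is defined, and the one coming from x.
-/
lemma mvfderiv_fiberVar_verticalLift {x y : M} (hy : y ∈ (trivializationAt ℂ L x).baseSet)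
    (l v : L y) :
    mvfderiv (𝓘(ℂ, V).prod 𝓘(ℂ, ℂ)) (fiberVar (L := L) x) (TotalSpace.mk y l)
      (verticalLift V y l v) = fiberVar x (TotalSpace.mk y v) := by
  have hc : MDifferentiableAt 𝓘(ℂ, ℂ) (𝓘(ℂ, V).prod 𝓘(ℂ, ℂ))
      (fun z : ℂ ↦ (TotalSpace.mk y (l + (fiberCoord y).symm z) : TotalSpace ℂ L)) 0 := by
    apply mdifferentiableAt_fiberCurve
    simp only [map_add, ContinuousLinearEquiv.apply_symm_apply]
    fun_prop
  have hcomp := HasMFDerivAt.comp (0 : ℂ) (hasMFDerivAt_fiberVar (V := V) hy l _ (by simp))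
    hc.hasMFDerivAt
  have hfun : fiberVar (L := L) x ∘
      (fun z : ℂ ↦ (TotalSpace.mk y (l + (fiberCoord y).symm z) : TotalSpace ℂ L)) =
      fun z : ℂ ↦ fiberVar x (TotalSpace.mk y l) +
        z * fiberVar x (TotalSpace.mk y ((fiberCoord (L := L) y).symm 1)) := by
    funext z
    rw [← fiberVar_smul hy, ← map_smul, smul_eq_mul, mul_one]
    exact fiberVar_add hy l _
  rw [hfun] at hcomp
  have hd : HasMFDerivAt 𝓘(ℂ, ℂ) 𝓘(ℂ, ℂ)
      (fun z : ℂ ↦ fiberVar x (TotalSpace.mk y l) +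
        z * fiberVar x (TotalSpace.mk y ((fiberCoord (L := L) y).symm 1))) 0 _ :=
    (((hasDerivAt_id (0 : ℂ)).mul_const
      (fiberVar x (TotalSpace.mk y ((fiberCoord (L := L) y).symm 1)))).const_add
        (fiberVar x (TotalSpace.mk y l))).hasFDerivAt.hasMFDerivAt
  have h := congrArg (fun f : ℂ →L[ℂ] ℂ ↦ f (fiberCoord y v)) (hasMFDerivAt_unique hcomp hd)
  refine Eq.trans h ?_
  -- Change of fibre coordinate: v is its coordinate at y times the vector whose coordinate at y is
  -- 1.
  have h2 := fiberVar_smul hy (fiberCoord y v) ((fiberCoord (L := L) y).symm 1)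
  rw [← map_smul, smul_eq_mul, mul_one, ContinuousLinearEquiv.symm_apply_apply] at h2
  rw [h2]
  simp

/-- The connection form of `D` in the local frame given by the preferred trivialization at `x`. -/
def connForm (D : CovariantDerivative 𝓘(ℂ, V) ℂ L) (x y : M) (X : TangentSpace 𝓘(ℂ, V) y) : ℂ :=
  fiberVar x (TotalSpace.mk y (D (frame x) y X))

lemma contMDiffOn_frame (x : M) :
    ContMDiffOn 𝓘(ℂ, V) (𝓘(ℂ, V).prod 𝓘(ℂ, ℂ)) ω
      (fun y : M ↦ (TotalSpace.mk y (frame x y) : TotalSpace ℂ L))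
      (trivializationAt ℂ L x).baseSet := by
  rw [(trivializationAt ℂ L x).contMDiffOn_section_baseSet_iff]
  refine (contMDiffOn_const (c := (1 : ℂ))).congr fun y hy ↦ ?_
  exact fiberVar_frame hy

lemma mdifferentiableAt_frame {x y : M} (hy : y ∈ (trivializationAt ℂ L x).baseSet) :
    MDifferentiableAt 𝓘(ℂ, V) (𝓘(ℂ, V).prod 𝓘(ℂ, ℂ))
      (fun y : M ↦ (TotalSpace.mk y (frame x y) : TotalSpace ℂ L)) y :=
  ((contMDiffOn_frame x).contMDiffAt ((trivializationAt ℂ L x).open_baseSet.mem_nhds hy)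
    ).mdifferentiableAt (by simp)

/-- The derivative of a section in terms of the connection form. -/
lemma fiberVar_covariantDerivative (D : CovariantDerivative 𝓘(ℂ, V) ℂ L) {x y : M}
    (hy : y ∈ (trivializationAt ℂ L x).baseSet) (σ : ∀ y, L y)
    (hσ : MDifferentiableAt 𝓘(ℂ, V) (𝓘(ℂ, V).prod 𝓘(ℂ, ℂ))
      (fun y : M ↦ (TotalSpace.mk y (σ y) : TotalSpace ℂ L)) y) (X : TangentSpace 𝓘(ℂ, V) y) :
    fiberVar x (TotalSpace.mk y (D σ y X)) =
      fiberVar x (TotalSpace.mk y (σ y)) * connForm D x y X +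
        mvfderiv 𝓘(ℂ, V) (fun y ↦ fiberVar x (TotalSpace.mk y (σ y))) y X := by
  have hf : MDifferentiableAt 𝓘(ℂ, V) 𝓘(ℂ, ℂ) (fun y ↦ fiberVar x (TotalSpace.mk y (σ y))) y :=
    MDifferentiableAt.comp (g := fiberVar (L := L) x) y
      (mdifferentiableAt_fiberVar (V := V) (q := TotalSpace.mk y (σ y)) hy) hσ
  -- The section equals its coordinate times the frame only near y; this suffices because D depends
  -- only on germs. The Leibniz rule then applies.
  have h1 : D σ y = D ((fun y ↦ fiberVar x (TotalSpace.mk y (σ y))) • frame x) y := by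
    refine D.isCovariantDerivativeOnUniv.congr_of_eventuallyEq hσ
      (hf.smul_section (mdifferentiableAt_frame hy)) Filter.univ_mem ?_
    filter_upwards [(trivializationAt ℂ L x).open_baseSet.mem_nhds hy] with z hz
    exact (fiberVar_smul_frame hz (σ z)).symm
  rw [h1, D.isCovariantDerivativeOnUniv.leibniz (mdifferentiableAt_frame hy) hf]
  simp only [add_apply, smul_apply, ContinuousLinearMap.smulRight_apply]
  rw [fiberVar_add hy, fiberVar_smul hy, fiberVar_smul hy, fiberVar_frame hy, mul_one]
  rfl

/-- If f is the coordinate of a section s through l, then ds(X) contributes X(f) and the vertical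
lift of D_X s contributes fθ(X) + X(f). The derivatives of f cancel in the difference, so the choice
of s does not matter. -/
lemma mvfderiv_fiberVar_horizontalLiftAt (D : CovariantDerivative 𝓘(ℂ, V) ℂ L) {x y : M}
    (hy : y ∈ (trivializationAt ℂ L x).baseSet) (l : L y) (X : TangentSpace 𝓘(ℂ, V) y) :
    mvfderiv (𝓘(ℂ, V).prod 𝓘(ℂ, ℂ)) (fiberVar (L := L) x) (TotalSpace.mk y l)
      (horizontalLiftAt D y l X) = - (fiberVar x (TotalSpace.mk y l) * connForm D x y X) := by
  have hcomp := HasMFDerivAt.comp y (hasMFDerivAt_fiberVar (V := V) hy l _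
    (by rw [localSection_self])) (mdifferentiableAt_localSection (V := V) y l).hasMFDerivAt
  have h2 := congrArg (fun f : V →L[ℂ] ℂ ↦ f X) hcomp.mfderiv
  have h3 := fiberVar_covariantDerivative D hy (localSection y l)
    (mdifferentiableAt_localSection (V := V) y l) X
  rw [localSection_self] at h3
  have h4 := map_sub (mvfderiv (𝓘(ℂ, V).prod 𝓘(ℂ, ℂ)) (fiberVar (L := L) x) (TotalSpace.mk y l))
    (dLocalSection V y l X) (verticalLift V y l (D (localSection y l) y X))
  refine Eq.trans h4 ?_
  rw [mvfderiv_fiberVar_verticalLift hy, h3]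
  refine Eq.trans (congrArg (fun z : ℂ ↦ z - _) h2.symm) ?_
  exact (sub_eq_iff_eq_add.2 (by ring_nf; rfl))

end Coordinates
end LineBundleAtiyah

/-! ### Sections of `E` in coordinates and their bracket -/

namespace LineBundleAtiyah

section Bracket

open VectorField

variable {V : Type*} [NormedAddCommGroup V] [NormedSpace ℂ V]
  {M : Type*} [TopologicalSpace M] [ChartedSpace V M] [IsManifold 𝓘(ℂ, V) ω M]
  {L : M → Type*} [TopologicalSpace (TotalSpace ℂ L)]
  [∀ x, AddCommGroup (L x)] [∀ x, Module ℂ (L x)] [∀ x, TopologicalSpace (L x)]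
  [∀ x, IsTopologicalAddGroup (L x)] [∀ x, ContinuousSMul ℂ (L x)]
  [FiberBundle ℂ L] [VectorBundle ℂ ℂ L] [ContMDiffVectorBundle ω ℂ L 𝓘(ℂ, V)]

/-- The element `e` of the fibre of `E` at `y` projects to the tangent vector `v`, and its vertical
part, in the fibre coordinate given by the preferred trivialization at `x`, is `c` times the
infinitesimal generator. -/
def HasCoords (x y : M) (e : AtiyahFiber V L y) (v : TangentSpace 𝓘(ℂ, V) y) (c : ℂ) : Prop :=
  ∀ l : {l : L y // l ≠ 0},
    mfderiv (𝓘(ℂ, V).prod 𝓘(ℂ, ℂ)) 𝓘(ℂ, V) (TotalSpace.proj : TotalSpace ℂ L → M)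
      (TotalSpace.mk y (l : L y)) (e.1 l) = v ∧
    mvfderiv (𝓘(ℂ, V).prod 𝓘(ℂ, ℂ)) (fiberVar (L := L) x) (TotalSpace.mk y (l : L y)) (e.1 l) =
      fiberVar x (TotalSpace.mk y (l : L y)) * c

lemma HasCoords.add {x y : M} {e e' : AtiyahFiber V L y} {v v' : TangentSpace 𝓘(ℂ, V) y} {c c' : ℂ}
    (h : HasCoords x y e v c) (h' : HasCoords x y e' v' c') :
    HasCoords x y (e + e') (v + v') (c + c') := fun l ↦
  ⟨(map_add (mfderiv (𝓘(ℂ, V).prod 𝓘(ℂ, ℂ)) 𝓘(ℂ, V) (TotalSpace.proj : TotalSpace ℂ L → M)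
      (TotalSpace.mk y (l : L y))) (e.1 l) (e'.1 l)).trans (congr_arg₂ _ (h l).1 (h' l).1),
    (map_add (mvfderiv (𝓘(ℂ, V).prod 𝓘(ℂ, ℂ)) (fiberVar (L := L) x) (TotalSpace.mk y (l : L y)))
      (e.1 l) (e'.1 l)).trans (by rw [(h l).2, (h' l).2, mul_add])⟩

lemma HasCoords.smul {x y : M} {e : AtiyahFiber V L y} {v : TangentSpace 𝓘(ℂ, V) y} {c : ℂ}
    (h : HasCoords x y e v c) (a : ℂ) : HasCoords x y (a • e) (a • v) (a * c) := fun l ↦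
  ⟨(map_smul (mfderiv (𝓘(ℂ, V).prod 𝓘(ℂ, ℂ)) 𝓘(ℂ, V) (TotalSpace.proj : TotalSpace ℂ L → M)
      (TotalSpace.mk y (l : L y))) a (e.1 l)).trans (congrArg (a • ·) (h l).1),
    (map_smul (mvfderiv (𝓘(ℂ, V).prod 𝓘(ℂ, ℂ)) (fiberVar (L := L) x) (TotalSpace.mk y (l : L y)))
      a (e.1 l)).trans (by rw [(h l).2, smul_eq_mul]; ring)⟩

/-- At the points over `x`, the preferred chart at `x` gives the components of a tangent vector. -/
lemma totTangent_eq (x : M) (l : L x) (w : TotTangent V x l) :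
    (w : V × ℂ) = (mfderiv (𝓘(ℂ, V).prod 𝓘(ℂ, ℂ)) 𝓘(ℂ, V) (TotalSpace.proj : TotalSpace ℂ L → M)
      (TotalSpace.mk x l) w,
      mvfderiv (𝓘(ℂ, V).prod 𝓘(ℂ, ℂ)) (fiberVar (L := L) x) (TotalSpace.mk x l) w) := by
  have h1 := mvfderiv_extChartAt_totalSpace (V := V) x l (q := TotalSpace.mk x l)
    (FiberBundle.mem_baseSet_trivializationAt' x) (mem_chart_source V x) w
  have h2 := mvfderiv_extChartAt_self (I := 𝓘(ℂ, V).prod 𝓘(ℂ, ℂ))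
    (TotalSpace.mk x l : TotalSpace ℂ L) w
  refine (h2.symm.trans h1).trans ?_
  exact congrArg (fun v : V ↦ (v, _)) (mvfderiv_extChartAt_self (I := 𝓘(ℂ, V)) x _)

/-- At the points over x, a tangent vector of the total space is the pair of its projection and its
fibre component, both of which are prescribed by v and c. -/
lemma HasCoords.ext {x : M} {e e' : AtiyahFiber V L x} {v : TangentSpace 𝓘(ℂ, V) x} {c : ℂ}
    (h : HasCoords x x e v c) (h' : HasCoords x x e' v c) : e = e' := by
  refine Subtype.ext (funext fun l ↦ ?_)
  refine (totTangent_eq x (l : L x) (e.1 l)).trans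
    (Eq.trans ?_ (totTangent_eq x (l : L x) (e'.1 l)).symm)
  rw [(h l).1, (h l).2, (h' l).1, (h' l).2]

lemma hasCoords_generator {x y : M} (hy : y ∈ (trivializationAt ℂ L x).baseSet) :
    HasCoords x y (generator (V := V) (L := L) y) 0 1 := fun l ↦
  ⟨dproj_generatorAt y (l : L y),
    (mvfderiv_fiberVar_generatorAt hy (l : L y)).trans (mul_one _).symm⟩

lemma hasCoords_horizontal (D : CovariantDerivative 𝓘(ℂ, V) ℂ L) {x y : M}
    (hy : y ∈ (trivializationAt ℂ L x).baseSet) (X : TangentSpace 𝓘(ℂ, V) y) :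
    HasCoords x y (horizontal D y X) X (-connForm D x y X) := fun l ↦
  ⟨dproj_horizontalLiftAt D y (l : L y) X,
    (mvfderiv_fiberVar_horizontalLiftAt D hy (l : L y) X).trans (mul_neg _ _).symm⟩

lemma hasCoords_unitSection (u : M → ℂ) {x y : M}
    (hy : y ∈ (trivializationAt ℂ L x).baseSet) :
    HasCoords x y (unitSection (V := V) (L := L) u y) 0 (u y)⁻¹ := by
  have h := (hasCoords_generator (V := V) hy).smul (u y)⁻¹
  rwa [smul_zero, mul_one] at h

section

variable {x : M} {s t : AtiyahSection V L} {X Y : ∀ y : M, TangentSpace 𝓘(ℂ, V) y} {c d : M → ℂ}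

/-- Links pointwise coordinates to the chart expression of the invariant vector field: the latter is
(X, zc) near a point off the zero section, so it can be differentiated. -/
lemma chartRep_toField_eventuallyEq (hs : ∀ᶠ y in 𝓝 x, HasCoords x y (s y) (X y) (c y))
    {l : L x} (hl : l ≠ 0) :
    chartRep (𝓘(ℂ, V).prod 𝓘(ℂ, ℂ)) (TotalSpace.mk x l : TotalSpace ℂ L) (toField s)
      =ᶠ[𝓝 (TotalSpace.mk x l)]
        fun q ↦ (chartRep 𝓘(ℂ, V) x X q.proj, fiberVar x q * c q.proj) := by
  have hproj : Filter.Tendsto (TotalSpace.proj : TotalSpace ℂ L → M) (𝓝 (TotalSpace.mk x l))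
      (𝓝 x) := (FiberBundle.continuous_proj ℂ L).tendsto _
  -- By continuity the fibre coordinate stays nonzero near the point, which keeps away from the zero
  -- section, where `toField` has its default value.
  have hcont := (mdifferentiableAt_fiberVar (V := V) (q := TotalSpace.mk x l)
    (FiberBundle.mem_baseSet_trivializationAt' x)).continuousAt
  filter_upwards [hproj.eventually hs, hproj.eventually (eventually_mem_chart_baseSet (V := V) (L := L) x),
    hcont.eventually_ne (fiberVar_ne_zero hl)] with q hq hqx hq0
  have hne : q.2 ≠ 0 := by
    intro h0
    have h1 := fiberVar_smul hqx.1 0 q.2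
    rw [zero_smul, zero_mul, ← h0] at h1
    exact hq0 h1
  have hf : toField s q = (s q.1).1 ⟨q.2, hne⟩ := dif_pos hne
  obtain ⟨h1, h2⟩ := hq ⟨q.2, hne⟩
  refine (mvfderiv_extChartAt_totalSpace (V := V) x l hqx.1 hqx.2 (toField s q)).trans ?_
  rw [hf]
  exact congr_arg₂ Prod.mk (congrArg (mvfderiv 𝓘(ℂ, V) (extChartAt 𝓘(ℂ, V) x) q.proj) h1) h2

lemma hasMFDerivAt_coords (hX : MDifferentiableAt 𝓘(ℂ, V) 𝓘(ℂ, V) (chartRep 𝓘(ℂ, V) x X) x)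
    (hc : MDifferentiableAt 𝓘(ℂ, V) 𝓘(ℂ, ℂ) c x) (l : L x) :
    HasMFDerivAt (𝓘(ℂ, V).prod 𝓘(ℂ, ℂ)) 𝓘(ℂ, V × ℂ)
      (fun q : TotalSpace ℂ L ↦ (chartRep 𝓘(ℂ, V) x X q.proj, fiberVar x q * c q.proj))
      (TotalSpace.mk x l)
      ((show V × ℂ →L[ℂ] V × ℂ from
        ((mvfderiv 𝓘(ℂ, V) (chartRep 𝓘(ℂ, V) x X) x).comp
          (mfderiv (𝓘(ℂ, V).prod 𝓘(ℂ, ℂ)) 𝓘(ℂ, V) (TotalSpace.proj : TotalSpace ℂ L → M)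
            (TotalSpace.mk x l))).prod
        (fiberVar x (TotalSpace.mk x l) • ((mvfderiv 𝓘(ℂ, V) c x).comp
          (mfderiv (𝓘(ℂ, V).prod 𝓘(ℂ, ℂ)) 𝓘(ℂ, V) (TotalSpace.proj : TotalSpace ℂ L → M)
            (TotalSpace.mk x l))) +
          c x • mvfderiv (𝓘(ℂ, V).prod 𝓘(ℂ, ℂ)) (fiberVar (L := L) x) (TotalSpace.mk x l)))) := by
  have hp := hasMFDerivAt_proj (V := V) x l _ rfl
  have h1 := HasMFDerivAt.comp (TotalSpace.mk x l : TotalSpace ℂ L) hX.hasMFDerivAt hp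
  have h2 := HasMFDerivAt.comp (TotalSpace.mk x l : TotalSpace ℂ L) hc.hasMFDerivAt hp
  have h3 := hasMFDerivAt_fiberVar (V := V) (FiberBundle.mem_baseSet_trivializationAt' x) l _ rfl
  exact hasMFDerivAt_prodMk_space h1 (h3.mul h2)

lemma diffAt_of_hasCoords (hs : ∀ᶠ y in 𝓝 x, HasCoords x y (s y) (X y) (c y))
    (hX : VectorFieldDiffAt X x) (hc : MDifferentiableAt 𝓘(ℂ, V) 𝓘(ℂ, ℂ) c x) : s.DiffAt x := by
  intro l hl
  rw [mdifferentiableAt_iff_chartRep]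
  exact (hasMFDerivAt_coords ((mdifferentiableAt_iff_chartRep x X).1 hX) hc l).mdifferentiableAt
    |>.congr_of_eventuallyEq (chartRep_toField_eventuallyEq hs hl)

/-- The bracket of sections of `E` in local coordinates. -/
lemma hasCoords_atiyahBracket [CompleteSpace V]
    (hs : ∀ᶠ y in 𝓝 x, HasCoords x y (s y) (X y) (c y))
    (ht : ∀ᶠ y in 𝓝 x, HasCoords x y (t y) (Y y) (d y))
    (hX : VectorFieldDiffAt X x) (hY : VectorFieldDiffAt Y x)
    (hc : MDifferentiableAt 𝓘(ℂ, V) 𝓘(ℂ, ℂ) c x) (hd : MDifferentiableAt 𝓘(ℂ, V) 𝓘(ℂ, ℂ) d x) :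
    HasCoords x x (atiyahBracket s t x) (mlieBracket 𝓘(ℂ, V) X Y x)
      (mvfderiv 𝓘(ℂ, V) d x (X x) - mvfderiv 𝓘(ℂ, V) c x (Y x)) := by
  intro l
  have hX' := (mdifferentiableAt_iff_chartRep x X).1 hX
  have hY' := (mdifferentiableAt_iff_chartRep x Y).1 hY
  have hbr : (atiyahBracket s t x).1 l = mlieBracket (𝓘(ℂ, V).prod 𝓘(ℂ, ℂ))
      (toField s) (toField t) (TotalSpace.mk x (l : L x)) := by
    -- Differentiable coordinates make both sections differentiable, so their bracket is invariant
    -- and the default value 0 is not used.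
    rw [atiyahBracket, dif_pos (dscale_mlieBracket s t x (diffAt_of_hasCoords hs hX hc)
      (diffAt_of_hasCoords ht hY hd))]
  have hds := (hasMFDerivAt_coords (L := L) hX' hc (l : L x)).congr_of_eventuallyEq
    (chartRep_toField_eventuallyEq hs l.2)
  have hdt := (hasMFDerivAt_coords (L := L) hY' hd (l : L x)).congr_of_eventuallyEq
    (chartRep_toField_eventuallyEq ht l.2)
  have h1 := mlieBracket_eq_chartRep (TotalSpace.mk x (l : L x) : TotalSpace ℂ L)
    (toField s) (toField t) hds.mdifferentiableAt hdt.mdifferentiableAt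
  have hfs : toField s (TotalSpace.mk x (l : L x)) = (s x).1 l := dif_pos l.2
  have hft : toField t (TotalSpace.mk x (l : L x)) = (t x).1 l := dif_pos l.2
  have h2 := mlieBracket_eq_chartRep x X Y hX' hY'
  have ks := hs.self_of_nhds l
  have kt := ht.self_of_nhds l
  have ms := congrArg (fun f : V × ℂ →L[ℂ] V × ℂ ↦ f ((t x).1 l)) hds.mfderiv
  have mt := congrArg (fun f : V × ℂ →L[ℂ] V × ℂ ↦ f ((s x).1 l)) hdt.mfderiv
  rw [hfs, hft] at h1
  have h3 : ((atiyahBracket s t x).1 l : V × ℂ) =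
      ((mlieBracket 𝓘(ℂ, V) X Y x : V), fiberVar x (TotalSpace.mk x (l : L x)) *
        (mvfderiv 𝓘(ℂ, V) d x (X x) - mvfderiv 𝓘(ℂ, V) c x (Y x))) := by
    refine (hbr.trans h1).trans ((congr_arg₂ (fun a b : V × ℂ ↦ a - b) mt ms).trans ?_)
    refine Prod.ext ?_ ?_
    · change mvfderiv 𝓘(ℂ, V) (chartRep 𝓘(ℂ, V) x Y) x
        (mfderiv (𝓘(ℂ, V).prod 𝓘(ℂ, ℂ)) 𝓘(ℂ, V) (TotalSpace.proj : TotalSpace ℂ L → M)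
          (TotalSpace.mk x (l : L x)) ((s x).1 l)) - mvfderiv 𝓘(ℂ, V) (chartRep 𝓘(ℂ, V) x X) x
        (mfderiv (𝓘(ℂ, V).prod 𝓘(ℂ, ℂ)) 𝓘(ℂ, V) (TotalSpace.proj : TotalSpace ℂ L → M)
          (TotalSpace.mk x (l : L x)) ((t x).1 l)) = _
      rw [ks.1, kt.1]
      exact h2.symm
    · change (fiberVar x (TotalSpace.mk x (l : L x)) * mvfderiv 𝓘(ℂ, V) d x
        (mfderiv (𝓘(ℂ, V).prod 𝓘(ℂ, ℂ)) 𝓘(ℂ, V) (TotalSpace.proj : TotalSpace ℂ L → M)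
          (TotalSpace.mk x (l : L x)) ((s x).1 l)) +
        d x * mvfderiv (𝓘(ℂ, V).prod 𝓘(ℂ, ℂ)) (fiberVar (L := L) x) (TotalSpace.mk x (l : L x))
          ((s x).1 l)) - (fiberVar x (TotalSpace.mk x (l : L x)) * mvfderiv 𝓘(ℂ, V) c x
        (mfderiv (𝓘(ℂ, V).prod 𝓘(ℂ, ℂ)) 𝓘(ℂ, V) (TotalSpace.proj : TotalSpace ℂ L → M)
          (TotalSpace.mk x (l : L x)) ((t x).1 l)) +
        c x * mvfderiv (𝓘(ℂ, V).prod 𝓘(ℂ, ℂ)) (fiberVar (L := L) x) (TotalSpace.mk x (l : L x))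
          ((t x).1 l)) = _
      -- The fibre component is z X(d) + dzc - (z Y(c) + czd): the products of z, c and d cancel.
      rw [ks.1, kt.1, ks.2, kt.2]
      ring
  have h4 := (totTangent_eq x (l : L x) ((atiyahBracket s t x).1 l)).symm.trans h3
  exact ⟨congrArg Prod.fst h4, congrArg Prod.snd h4⟩

end

end Bracket
end LineBundleAtiyah

/-! ### Curvature as the exterior derivative of the connection form -/

namespace LineBundleAtiyah

section Curvature

open VectorField

variable {V : Type*} [NormedAddCommGroup V] [NormedSpace ℂ V]
  {M : Type*} [TopologicalSpace M] [ChartedSpace V M] [IsManifold 𝓘(ℂ, V) ω M]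
  {L : M → Type*} [TopologicalSpace (TotalSpace ℂ L)]
  [∀ x, AddCommGroup (L x)] [∀ x, Module ℂ (L x)] [∀ x, TopologicalSpace (L x)]
  [∀ x, IsTopologicalAddGroup (L x)] [∀ x, ContinuousSMul ℂ (L x)]
  [FiberBundle ℂ L] [VectorBundle ℂ ℂ L] [ContMDiffVectorBundle ω ℂ L 𝓘(ℂ, V)]
  {D : CovariantDerivative 𝓘(ℂ, V) ℂ L} {x : M} {X X' Y : ∀ y : M, TangentSpace 𝓘(ℂ, V) y}

lemma connForm_add {y : M} (hy : y ∈ (trivializationAt ℂ L x).baseSet)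
    (v w : TangentSpace 𝓘(ℂ, V) y) :
    connForm D x y (v + w) = connForm D x y v + connForm D x y w := by
  rw [connForm, map_add, fiberVar_add hy]
  rfl

lemma connForm_smul {y : M} (hy : y ∈ (trivializationAt ℂ L x).baseSet) (a : ℂ)
    (v : TangentSpace 𝓘(ℂ, V) y) : connForm D x y (a • v) = a * connForm D x y v := by
  rw [connForm, map_smul, fiberVar_smul hy]
  rfl

/-- The frame is holomorphic, so holomorphy of the connection makes its covariant derivative a
holomorphic section of Hom(TM, L). This is what permits θ(X) to be differentiated again. -/
lemma mdifferentiableAt_covariantDerivative_frame (hD : IsHolomorphicConnection D)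
    (hX : VectorFieldDiffAt X x) :
    MDifferentiableAt 𝓘(ℂ, V) (𝓘(ℂ, V).prod 𝓘(ℂ, ℂ))
      (fun y ↦ (TotalSpace.mk y (D (frame x) y (X y)) : TotalSpace ℂ L)) x := by
  have h1 := (hD _ (trivializationAt ℂ L x).open_baseSet).contMDiff (σ := frame x)
    (contMDiffOn_frame x)
  have h2 := (h1.contMDiffAt ((trivializationAt ℂ L x).open_baseSet.mem_nhds
    (FiberBundle.mem_baseSet_trivializationAt' x))).mdifferentiableAt (by simp)
  exact h2.clm_bundle_apply hX

lemma mdifferentiableAt_connForm (hD : IsHolomorphicConnection D) (hX : VectorFieldDiffAt X x) :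
    MDifferentiableAt 𝓘(ℂ, V) 𝓘(ℂ, ℂ) (fun y ↦ connForm D x y (X y)) x :=
  MDifferentiableAt.comp (g := fiberVar (L := L) x) x
    (mdifferentiableAt_fiberVar (V := V) (q := TotalSpace.mk x (D (frame x) x (X x)))
      (FiberBundle.mem_baseSet_trivializationAt' x))
    (mdifferentiableAt_covariantDerivative_frame hD hX)

variable (D x) in
/-- The exterior derivative at `x` of the connection form, evaluated on vector fields. -/
def dConnForm (X Y : ∀ y : M, TangentSpace 𝓘(ℂ, V) y) : ℂ :=
  mvfderiv 𝓘(ℂ, V) (fun y ↦ connForm D x y (Y y)) x (X x) -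
    mvfderiv 𝓘(ℂ, V) (fun y ↦ connForm D x y (X y)) x (Y x) -
    connForm D x x (mlieBracket 𝓘(ℂ, V) X Y x)

lemma mvfderiv_congr {f g : M → ℂ} (h : f =ᶠ[𝓝 x] g) (v : TangentSpace 𝓘(ℂ, V) x) :
    mvfderiv 𝓘(ℂ, V) f x v = mvfderiv 𝓘(ℂ, V) g x v :=
  congrArg (fun A : V →L[ℂ] ℂ ↦ A v) h.mfderiv_eq

/-- When X is replaced by fX, the term -Y(fθ(X)) yields -Y(f)θ(X), and this cancels against the
contribution of -Y(f)X in [fX, Y]. Tensoriality is needed because the curvature form uses chosen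
extensions of tangent vectors, while the brackets involve arbitrary fields. -/
lemma tensorialAt_dConnForm_left [CompleteSpace V] (hD : IsHolomorphicConnection D)
    (Y : ∀ y : M, TangentSpace 𝓘(ℂ, V) y) :
    TensorialAt 𝓘(ℂ, V) V (fun X ↦ dConnForm D x X Y) x where
  smul {f X} hf hX := by
    have hx : x ∈ (trivializationAt ℂ L x).baseSet := FiberBundle.mem_baseSet_trivializationAt' x
    have h1 : (fun y ↦ connForm D x y ((f • X) y)) =ᶠ[𝓝 x]
        f * fun y ↦ connForm D x y (X y) := by
      filter_upwards [(trivializationAt ℂ L x).open_baseSet.mem_nhds hx] with y hy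
      exact connForm_smul hy (f y) (X y)
    have h2 := mlieBracket_smul_left (W := Y) hf hX
    simp only [dConnForm]
    rw [mvfderiv_congr h1, mvfderiv_mul hf (mdifferentiableAt_connForm hD hX), h2,
      connForm_add hx, connForm_smul hx, connForm_smul hx]
    simp
    ring
  add {X X'} hX hX' := by
    have hx : x ∈ (trivializationAt ℂ L x).baseSet := FiberBundle.mem_baseSet_trivializationAt' x
    have h1 : (fun y ↦ connForm D x y ((X + X') y)) =ᶠ[𝓝 x]
        (fun y ↦ connForm D x y (X y)) + fun y ↦ connForm D x y (X' y) := by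
      filter_upwards [(trivializationAt ℂ L x).open_baseSet.mem_nhds hx] with y hy
      exact connForm_add hy (X y) (X' y)
    have h2 := mlieBracket_add_left (W := Y) hX hX'
    simp only [dConnForm]
    rw [mvfderiv_congr h1, mvfderiv_add (mdifferentiableAt_connForm hD hX)
      (mdifferentiableAt_connForm hD hX'), h2, connForm_add hx]
    simp
    ring

lemma dConnForm_swap (X Y : ∀ y : M, TangentSpace 𝓘(ℂ, V) y) :
    dConnForm D x X Y = - dConnForm D x Y X := by
  have h := connForm_smul (D := D) (FiberBundle.mem_baseSet_trivializationAt' x) (-1)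
    (mlieBracket 𝓘(ℂ, V) Y X x)
  rw [dConnForm, dConnForm, mlieBracket_swap_apply, ← neg_one_smul ℂ, h]
  ring

/-- The curvature form is the exterior derivative of the connection form. -/
lemma curvatureForm_eq_dConnForm [FiniteDimensional ℂ V] [CompleteSpace V]
    (hD : IsHolomorphicConnection D) (hX : VectorFieldDiffAt X x) (hY : VectorFieldDiffAt Y x) :
    curvatureForm D x (X x) (Y x) = dConnForm D x X Y := by
  have hx : x ∈ (trivializationAt ℂ L x).baseSet := FiberBundle.mem_baseSet_trivializationAt' x
  have hext (v : TangentSpace 𝓘(ℂ, V) x) : VectorFieldDiffAt (FiberBundle.extend V v) x :=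
    FiberBundle.mdifferentiableAt_extend 𝓘(ℂ, V) V v
  have hval (v : TangentSpace 𝓘(ℂ, V) x) : FiberBundle.extend V v x = v := by simp
  have h1 : dConnForm D x X Y =
      dConnForm D x (FiberBundle.extend V (X x)) (FiberBundle.extend V (Y x)) := by
    -- The first argument is replaced by the extension of its value; antisymmetry reduces the second
    -- argument to the same case.
    rw [(tensorialAt_dConnForm_left hD Y).pointwise hX (hext (X x)) (hval _).symm,
      dConnForm_swap, (tensorialAt_dConnForm_left hD _).pointwise hY (hext (Y x)) (hval _).symm,
      ← dConnForm_swap]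
  rw [h1]
  -- On the frame, D_X D_Y has coordinate θ(Y)θ(X) + X(θ(Y)). The product is symmetric in X and Y,
  -- as L has rank one, so it disappears from the commutator.
  have h2 {X Y : ∀ y : M, TangentSpace 𝓘(ℂ, V) y} (hY : VectorFieldDiffAt Y x) :
      fiberCoord x (D (fun y ↦ D (frame x) y (Y y)) x (X x)) =
        connForm D x x (Y x) * connForm D x x (X x) +
          mvfderiv 𝓘(ℂ, V) (fun y ↦ connForm D x y (Y y)) x (X x) :=
    fiberVar_covariantDerivative D hx _ (mdifferentiableAt_covariantDerivative_frame hD hY) (X x)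
  have h3 : curvatureForm D x (X x) (Y x) = fiberCoord x (curvatureOperator D
      (FiberBundle.extend V (X x)) (FiberBundle.extend V (Y x)) (frame x) x) := rfl
  rw [h3, curvatureOperator, map_sub, map_sub, h2 (hext (X x)), h2 (hext (Y x)), dConnForm]
  have h4 (v : TangentSpace 𝓘(ℂ, V) x) :
    fiberCoord x (D (frame x) x v) = connForm D x x v := rfl
  rw [h4]
  ring

/-! ### The two brackets that determine the torsion -/

/-- The bracket of the horizontal lifts of two vector fields. -/
lemma atiyahBracket_horizontal_horizontal [FiniteDimensional ℂ V] [CompleteSpace V]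
    (hD : IsHolomorphicConnection D) (hX : VectorFieldDiffAt X x) (hY : VectorFieldDiffAt Y x) :
    atiyahBracket (fun y ↦ horizontal D y (X y)) (fun y ↦ horizontal D y (Y y)) x =
      horizontal D x (mlieBracket 𝓘(ℂ, V) X Y x) +
        (-curvatureForm D x (X x) (Y x)) • generator x := by
  have hx : x ∈ (trivializationAt ℂ L x).baseSet := FiberBundle.mem_baseSet_trivializationAt' x
  have hc (Z : ∀ y : M, TangentSpace 𝓘(ℂ, V) y) : ∀ᶠ y in 𝓝 x,
      HasCoords x y (horizontal D y (Z y)) (Z y) ((-fun y ↦ connForm D x y (Z y)) y) := by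
    filter_upwards [(trivializationAt ℂ L x).open_baseSet.mem_nhds hx] with y hy
    exact hasCoords_horizontal D hy (Z y)
  have h1 := hasCoords_atiyahBracket (hc X) (hc Y) hX hY
    (mdifferentiableAt_connForm hD hX).neg (mdifferentiableAt_connForm hD hY).neg
  have h2 := (hasCoords_horizontal D hx (mlieBracket 𝓘(ℂ, V) X Y x)).add
    ((hasCoords_generator (V := V) hx).smul (-curvatureForm D x (X x) (Y x)))
  rw [smul_zero, add_zero, curvatureForm_eq_dConnForm hD hX hY] at h2
  rw [curvatureForm_eq_dConnForm hD hX hY]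
  refine h1.ext ?_
  -- Only the vertical coordinates remain: -X(θ(Y)) + Y(θ(X)) = -θ([X, Y]) - dθ(X, Y).
  convert h2 using 1
  rw [mvfderiv_neg, mvfderiv_neg, dConnForm]
  simp
  ring

lemma mvfderiv_inv {u : M → ℂ} (hu : MDifferentiableAt 𝓘(ℂ, V) 𝓘(ℂ, ℂ) u x) (hu0 : u x ≠ 0) :
    MDifferentiableAt 𝓘(ℂ, V) 𝓘(ℂ, ℂ) (fun y ↦ (u y)⁻¹) x ∧
      ∀ v, mvfderiv 𝓘(ℂ, V) (fun y ↦ (u y)⁻¹) x v =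
        -((u x)⁻¹ * mvfderiv 𝓘(ℂ, V) u x v) * (u x)⁻¹ := by
  have h : HasMFDerivAt 𝓘(ℂ, V) 𝓘(ℂ, ℂ) ((fun z : ℂ ↦ z⁻¹) ∘ u) x _ :=
    HasMFDerivAt.comp x (hasDerivAt_inv hu0).hasFDerivAt.hasMFDerivAt hu.hasMFDerivAt
  refine ⟨h.mdifferentiableAt, fun v ↦ ?_⟩
  have h1 := congrArg (fun A : V →L[ℂ] ℂ ↦ A v) h.mfderiv
  refine Eq.trans h1 ?_
  change mvfderiv 𝓘(ℂ, V) u x v * -(u x ^ 2)⁻¹ = _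
  field_simp

/-- The bracket of the horizontal lift of a vector field with `𝟏`. -/
lemma atiyahBracket_horizontal_unitSection [CompleteSpace V]
    (hD : IsHolomorphicConnection D) {u : M → ℂ} (hu : MDifferentiableAt 𝓘(ℂ, V) 𝓘(ℂ, ℂ) u x)
    (hu0 : u x ≠ 0) (hX : VectorFieldDiffAt X x) :
    atiyahBracket (fun y ↦ horizontal D y (X y)) (unitSection u) x =
      (-((u x)⁻¹ * mvfderiv 𝓘(ℂ, V) u x (X x))) • unitSection u x := by
  have hx : x ∈ (trivializationAt ℂ L x).baseSet := FiberBundle.mem_baseSet_trivializationAt' x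
  have hb := (trivializationAt ℂ L x).open_baseSet.mem_nhds hx
  have hs : ∀ᶠ y in 𝓝 x,
      HasCoords x y (horizontal D y (X y)) (X y) ((-fun y ↦ connForm D x y (X y)) y) := by
    filter_upwards [hb] with y hy
    exact hasCoords_horizontal D hy (X y)
  have ht : ∀ᶠ y in 𝓝 x, HasCoords x y (unitSection (V := V) (L := L) u y)
      ((0 : ∀ y : M, TangentSpace 𝓘(ℂ, V) y) y) (u y)⁻¹ := by
    filter_upwards [hb] with y hy
    exact hasCoords_unitSection u hy
  have h0 : VectorFieldDiffAt (0 : ∀ y : M, TangentSpace 𝓘(ℂ, V) y) x :=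
    mdifferentiableAt_zeroSection ..
  have hi := mvfderiv_inv hu hu0
  have h1 := hasCoords_atiyahBracket hs ht hX h0 (mdifferentiableAt_connForm hD hX).neg hi.1
  have h2 := (hasCoords_unitSection (V := V) u hx).smul
    (-((u x)⁻¹ * mvfderiv 𝓘(ℂ, V) u x (X x)))
  -- As 𝟏 has zero base component, the bracket has coordinates (0, X(u⁻¹)); the connection form
  -- plays no role.
  rw [mlieBracket_zero_right, hi.2, Pi.zero_apply, map_zero, sub_zero] at h1
  rw [smul_zero] at h2
  exact h1.ext h2

end Curvature
end LineBundleAtiyah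

end

/-! ### The torsion formulas -/

theorem proposition1p2
    {V : Type*} [NormedAddCommGroup V] [NormedSpace ℂ V] [FiniteDimensional ℂ V] [CompleteSpace V]
    {M : Type*} [TopologicalSpace M] [ChartedSpace V M] [IsManifold 𝓘(ℂ, V) ω M]
    {L : M → Type*} [TopologicalSpace (TotalSpace ℂ L)]
    [∀ x, AddCommGroup (L x)] [∀ x, Module ℂ (L x)] [∀ x, TopologicalSpace (L x)]
    [∀ x, IsTopologicalAddGroup (L x)] [∀ x, ContinuousSMul ℂ (L x)]
    [FiberBundle ℂ L] [VectorBundle ℂ ℂ L] [ContMDiffVectorBundle ω ℂ L 𝓘(ℂ, V)]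
    (D : CovariantDerivative 𝓘(ℂ, V) ℂ L) (hD : IsHolomorphicConnection D)
    (u : M → ℂ) (hu : ContMDiff 𝓘(ℂ, V) 𝓘(ℂ, ℂ) ω u) (hu0 : ∀ x, u x ≠ 0)
    (g : HolomorphicMetric V M)
    (h : ∀ x : M, TangentSpace 𝓘(ℂ, V) x →ₗ[ℂ]
      TangentSpace 𝓘(ℂ, V) x →ₗ[ℂ] TangentSpace 𝓘(ℂ, V) x)
    (γ : ∀ x : M, AtiyahFiber V L x →ₗ[ℂ] TangentSpace 𝓘(ℂ, V) x)
    (nab : RhoConnectionTM V L) (nabE : RhoConnectionE V L)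
    (hnab : IsTildeConnection D u g h γ nab nabE) :
    (∀ (x : M) (X Y : ∀ y : M, TangentSpace 𝓘(ℂ, V) y),
      VectorFieldDiffAt X x → VectorFieldDiffAt Y x →
      rhoTorsion nabE (fun y ↦ horizontal D y (X y)) (fun y ↦ horizontal D y (Y y)) x =
        horizontal D x ((inducedConnection D nab).torsion x (X x) (Y x)
          + h x (γ x (horizontal D x (X x))) (Y x) - h x (γ x (horizontal D x (Y x))) (X x))
        + (u x * curvatureForm D x (X x) (Y x)
          - g.inner x (γ x (horizontal D x (X x))) (Y x)
          + g.inner x (γ x (horizontal D x (Y x))) (X x)) • unitSection u x) ∧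
    (∀ (x : M) (X : ∀ y : M, TangentSpace 𝓘(ℂ, V) y), VectorFieldDiffAt X x →
      rhoTorsion nabE (fun y ↦ horizontal D y (X y)) (unitSection u) x =
        horizontal D x (γ x (horizontal D x (X x)) - nab.toFun X x (unitSection u x)
          - h x (γ x (unitSection u x)) (X x))
        + ((u x)⁻¹ * mvfderiv 𝓘(ℂ, V) u x (X x)
          + g.inner x (γ x (unitSection u x)) (X x)) • unitSection u x) := by
  constructor
  · intro x X Y hX hY
    have hT := (inducedConnection D nab).torsion_apply hX hY
    have hc (Z W : ∀ y : M, TangentSpace 𝓘(ℂ, V) y) : inducedConnection D nab Z x (W x) =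
      nab.toFun Z x (horizontal D x (W x)) := rfl
    -- Expresses the curvature term of the bracket through 𝟏: -Ω times the generator is -uΩ𝟏, and
    -- the bracket enters the torsion with a minus sign, whence +uΩ.
    have hgen : generator (V := V) (L := L) x = u x • unitSection u x := by
      rw [unitSection, smul_inv_smul₀ (hu0 x)]
    rw [hT, hc, hc, rhoTorsion, hnab.horizontal_horizontal x (X x) Y hY,
      hnab.horizontal_horizontal x (Y x) X hX, atiyahBracket_horizontal_horizontal hD hX hY, hgen]
    simp only [map_add, map_sub]
    module
  · intro x X hX
    rw [rhoTorsion, hnab.horizontal_unit, hnab.unit_horizontal x X hX,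
      atiyahBracket_horizontal_unitSection hD ((hu x).mdifferentiableAt (by simp)) (hu0 x) hX]
    simp only [map_add, map_sub]
    module
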